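/- Let $R=\bigoplus_{n\ge 0}R_n$ be a standard graded Noetherian ring, i.e. $R_0$ is a commutative Noetherian ring and $R$ is generated as an $R_0$-algebra by finitely many elements of degree one, and assume that $R_0$ is local. Let $R_+=\bigoplus_{n\ge 1}R_n$, let $\mathfrak a$ be any homogeneous ideal of $R$ and let $M$ be a finitely generated $\mathbb Z$-graded $R$-module. For $i\ge 0$ let $H^i_{\mathfrak a}(M)=\bigoplus_{n\in\mathbb Z}H^i_{\mathfrak a}(M)_n$ be the $i$-th graded local cohomology module, i.e. the $i$-th right derived functor, on the category of graded $R$-modules, of $\Gamma_{\mathfrak a}(M)=\{x\in M : \mathfrak a^k x=0 \text{ for some } k\}$, applied to $M$. Put $$f_{\mathfrak a}^{R_+}(M)=\sup\{k\in\mathbb N_0 : R_+\subseteq\sqrt{0:_R H^i_{\mathfrak a}(M)}\text{ for all } i<k\}\in\mathbb N_0\cup\{\infty\}.$$ If $f:=f_{\mathfrak a}^{R_+}(M)<\infty$, then $H^{f}_{\mathfrak a}(M)$ is tame: the set $\{n\in\mathbb Z : H^f_{\mathfrak a}(M)_n=0 \text{ and } H^f_{\mathfrak a}(M)_{n+1}\neq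 0\}$ is finite. -/

import Mathlib

universe u v w

/-- A `ℤ`-graded module `N = ⨁ Nₙ` over the `ℕ`-graded ring `R = ⨁ 𝒜 i`. -/
structure GrMod {R : Type u} [CommRing R] (𝒜 : ℕ → AddSubgroup R) : Type (max u (v + 1)) where
  carrier : Type v
  [addCommGroup : AddCommGroup carrier]
  [module : Module R carrier]
  /-- the homogeneous components -/
  deg : ℤ → AddSubgroup carrier
  [decomposition : DirectSum.Decomposition deg]
  smul_mem : ∀ (i : ℕ) (n : ℤ) (r : R) (x : carrier),
    r ∈ 𝒜 i → x ∈ deg n → r • x ∈ deg (i + n)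

namespace GrMod

attribute [instance] addCommGroup module decomposition

noncomputable section

section basic

variable {R : Type u} [CommRing R] {𝒜 : ℕ → AddSubgroup R}

instance : CoeSort (GrMod.{u, v} 𝒜) (Type v) := ⟨carrier⟩

/-- The projection of a graded module onto its component of degree `n`. -/
def proj (M : GrMod.{u, v} 𝒜) (n : ℤ) : M →+ M :=
  (M.deg n).subtype.comp
    ((DFinsupp.evalAddMonoidHom n).comp (DirectSum.decomposeAddEquiv M.deg).toAddMonoidHom)

theorem proj_apply (M : GrMod.{u, v} 𝒜) (n : ℤ) (x : M) :
    M.proj n x = (DirectSum.decompose M.deg x n : M) := rfl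

theorem proj_mem (M : GrMod.{u, v} 𝒜) (n : ℤ) (x : M) : M.proj n x ∈ M.deg n :=
  (DirectSum.decompose M.deg x n).2

theorem proj_same (M : GrMod.{u, v} 𝒜) {n : ℤ} {x : M} (hx : x ∈ M.deg n) :
    M.proj n x = x := DirectSum.decompose_of_mem_same M.deg hx

theorem proj_ne (M : GrMod.{u, v} 𝒜) {m n : ℤ} {x : M} (hx : x ∈ M.deg m) (h : m ≠ n) :
    M.proj n x = 0 := DirectSum.decompose_of_mem_ne M.deg hx h

theorem sum_proj (M : GrMod.{u, v} 𝒜) (x : M) : ∃ s : Finset ℤ, ∑ n ∈ s, M.proj n x = x := by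
  classical
  exact ⟨_, DirectSum.sum_support_decompose M.deg x⟩

theorem eq_of_proj (M : GrMod.{u, v} 𝒜) {x : M} (h : ∀ n, M.proj n x = 0) : x = 0 := by
  obtain ⟨s, hs⟩ := M.sum_proj x
  rw [← hs]
  exact Finset.sum_eq_zero fun n _ => h n

/-- The product of a homogeneous element of `R` with the homogeneous components. -/
theorem proj_smul (M : GrMod.{u, v} 𝒜) {i : ℕ} {r : R} (hr : r ∈ 𝒜 i) (n : ℤ) (x : M) :
    M.proj (i + n) (r • x) = r • M.proj n x := by
  obtain ⟨s, hs⟩ := M.sum_proj x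
  have key : ∀ m, M.proj (i + n) (r • M.proj m x) = r • M.proj n (M.proj m x) := by
    intro m
    have hm := M.proj_mem m x
    by_cases h : m = n
    · subst h
      rw [M.proj_same (M.smul_mem i m r _ hr hm), M.proj_same hm]
    · rw [M.proj_ne (M.smul_mem i m r _ hr hm) (by omega), M.proj_ne hm h, smul_zero]
  conv_lhs => rw [← hs]
  conv_rhs => rw [← hs]
  rw [Finset.smul_sum, map_sum, map_sum, Finset.smul_sum]
  exact Finset.sum_congr rfl fun m _ => key m

/-- A family of subgroups with compatible projections that spans is a decomposition. -/
@[reducible] def decompositionOfProj {P : Type w} [AddCommGroup P] (d : ℤ → AddSubgroup P)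
    (p : ℤ → P →+ P) (hsame : ∀ n, ∀ x ∈ d n, p n x = x)
    (hne : ∀ m n, m ≠ n → ∀ x ∈ d m, p n x = 0)
    (hsum : ∀ x : P, x ∈ ⨆ n, d n) : DirectSum.Decomposition d := by
  refine DirectSum.IsInternal.chooseDecomposition d ⟨?_, ?_⟩
  · rw [injective_iff_map_eq_zero]
    intro a ha
    have hp : ∀ n, (p n).comp (DirectSum.coeAddMonoidHom d) =
        (d n).subtype.comp (DFinsupp.evalAddMonoidHom n) := by
      intro n
      refine DirectSum.addHom_ext fun m y => ?_
      simp only [AddMonoidHom.comp_apply, DirectSum.coeAddMonoidHom_of]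
      by_cases h : m = n
      · subst h
        rw [hsame m _ y.2]
        exact (congrArg Subtype.val
          (DirectSum.of_eq_same (β := fun n => d n) m y)).symm
      · rw [hne m n h _ y.2]
        exact (congrArg Subtype.val
          (DirectSum.of_eq_of_ne (β := fun n => d n) m n y (Ne.symm h))).symm
    refine DFinsupp.ext fun n => Subtype.ext ?_
    have := DFunLike.congr_fun (hp n) a
    simp only [AddMonoidHom.comp_apply, ha, map_zero] at this
    exact this.symm
  · intro x
    refine AddSubgroup.iSup_induction d (C := fun x => ∃ a, DirectSum.coeAddMonoidHom d a = x)
      (hsum x) ?_ ⟨0, map_zero _⟩ ?_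
    · intro n y hy
      exact ⟨DirectSum.of (fun n => d n) n ⟨y, hy⟩, DirectSum.coeAddMonoidHom_of d n ⟨y, hy⟩⟩
    · rintro y z ⟨a, rfl⟩ ⟨b, rfl⟩
      exact ⟨a + b, map_add _ _ _⟩

/-- Homomorphisms of graded modules: `R`-linear maps that preserve degrees. -/
def IsGradedHom {M : GrMod.{u, v} 𝒜} {N : GrMod.{u, w} 𝒜} (f : M →ₗ[R] N) : Prop :=
  ∀ (n : ℤ) (x : M), x ∈ M.deg n → f x ∈ N.deg n

theorem IsGradedHom.proj {M : GrMod.{u, v} 𝒜} {N : GrMod.{u, w} 𝒜} {f : M →ₗ[R] N}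
    (hf : IsGradedHom f) (n : ℤ) (x : M) : N.proj n (f x) = f (M.proj n x) := by
  obtain ⟨s, hs⟩ := M.sum_proj x
  have key : ∀ m, N.proj n (f (M.proj m x)) = f (M.proj n (M.proj m x)) := by
    intro m
    have hm := M.proj_mem m x
    by_cases h : m = n
    · subst h
      rw [M.proj_same hm, N.proj_same (hf _ _ hm)]
    · rw [M.proj_ne hm h, N.proj_ne (hf _ _ hm) h, map_zero]
  rw [← hs]
  simp only [map_sum]
  exact Finset.sum_congr rfl fun m _ => key m

/-- A submodule is homogeneous if it contains the components of its elements. -/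
def IsHomogeneousSub (M : GrMod.{u, v} 𝒜) (N : Submodule R M) : Prop :=
  ∀ x ∈ N, ∀ n, M.proj n x ∈ N

/-- A homogeneous submodule `N ⊆ M` as a graded module, `Nₙ = N ∩ Mₙ`. -/
def sub (M : GrMod.{u, v} 𝒜) (N : Submodule R M) (hN : M.IsHomogeneousSub N) :
    GrMod.{u, v} 𝒜 where
  carrier := N
  deg n := (M.deg n).comap N.subtype.toAddMonoidHom
  decomposition := decompositionOfProj _
    (fun n => ((M.proj n).comp N.subtype.toAddMonoidHom).codRestrict N.toAddSubgroup
      (fun x => hN x x.2 n))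
    (fun _ _ hx => Subtype.ext (M.proj_same hx))
    (fun _ _ h _ hx => Subtype.ext (M.proj_ne hx h))
    (fun x => by
      obtain ⟨s, hs⟩ := M.sum_proj (x : M)
      have : x = ∑ n ∈ s, (⟨M.proj n x, hN x x.2 n⟩ : N) := by
        refine Subtype.ext ?_
        rw [AddSubmonoidClass.coe_finsetSum]
        exact hs.symm
      rw [this]
      exact sum_mem fun n _ => AddSubgroup.mem_iSup_of_mem n (M.proj_mem n x))
  smul_mem i n r x hr hx := M.smul_mem i n r x hr hx

theorem sub_proj (M : GrMod.{u, v} 𝒜) (N : Submodule R M) (hN : M.IsHomogeneousSub N)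
    (n : ℤ) (x : M.sub N hN) :
    (show N from (M.sub N hN).proj n x).1 = M.proj n (show N from x).1 :=
  (IsGradedHom.proj (M := M.sub N hN) (N := M) (f := N.subtype) (fun _ _ hx => hx) n x).symm

/-- The quotient `M / N` by a homogeneous submodule, `(M / N)ₙ = (Mₙ + N) / N`. -/
def quot (M : GrMod.{u, v} 𝒜) (N : Submodule R M) (hN : M.IsHomogeneousSub N) :
    GrMod.{u, v} 𝒜 where
  carrier := M ⧸ N
  deg n := (M.deg n).map N.mkQ.toAddMonoidHom
  decomposition := decompositionOfProj _
    (fun n => QuotientAddGroup.map N.toAddSubgroup N.toAddSubgroup (M.proj n)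
      (fun x hx => hN x hx n))
    (by
      rintro n _ ⟨x, hx, rfl⟩
      exact congrArg N.mkQ (M.proj_same hx))
    (by
      rintro m n h _ ⟨x, hx, rfl⟩
      exact (congrArg N.mkQ (M.proj_ne hx h)).trans (map_zero _))
    (fun y => by
      obtain ⟨x, rfl⟩ := N.mkQ_surjective y
      obtain ⟨s, hs⟩ := M.sum_proj x
      rw [← hs, map_sum]
      exact sum_mem fun n _ => AddSubgroup.mem_iSup_of_mem n ⟨_, M.proj_mem n x, rfl⟩)
  smul_mem i n r y hr hy := by
    obtain ⟨x, hx, rfl⟩ := hy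
    exact ⟨r • x, M.smul_mem i n r x hr hx, N.mkQ.map_smul r x⟩

/-- `N` is tame if `{n | Nₙ = 0, Nₙ₊₁ ≠ 0}` is finite. -/
def IsTame (N : GrMod.{u, v} 𝒜) : Prop :=
  {n : ℤ | N.deg n = ⊥ ∧ N.deg (n + 1) ≠ ⊥}.Finite

/-- Injective objects of the category of graded modules: homomorphisms of graded modules into
`E` extend along injective homomorphisms of graded modules. -/
def IsGrInjective (E : GrMod.{u, v} 𝒜) : Prop :=
  ∀ (L N : GrMod.{u, v} 𝒜) (j : L →ₗ[R] N) (g : L →ₗ[R] E),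
    IsGradedHom j → Function.Injective j → IsGradedHom g →
      ∃ h : N →ₗ[R] E, IsGradedHom h ∧ ∀ x, h (j x) = g x

/-- A resolution `0 → M → E⁰ → E¹ → ⋯` by injective objects of the category of graded modules. -/
structure InjRes (M : GrMod.{u, v} 𝒜) where
  E : ℕ → GrMod.{u, max u v} 𝒜
  d : ∀ i, E i →ₗ[R] E (i + 1)
  ε : M →ₗ[R] E 0
  injective : ∀ i, (E i).IsGrInjective
  graded_d : ∀ i, IsGradedHom (d i)
  graded_ε : IsGradedHom ε
  ε_injective : Function.Injective ε
  exact_zero : LinearMap.range ε = LinearMap.ker (d 0)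
  exact_succ : ∀ i, LinearMap.range (d i) = LinearMap.ker (d (i + 1))

end basic

section enough

/-! Every graded module has a resolution by graded injectives. -/

variable {R : Type u} [CommRing R] (𝒜 : ℕ → AddSubgroup R) [GradedRing 𝒜]

/-- The projection of `R` onto the component of degree `z`, which is `0` for `z < 0`. -/
def ringProj (z : ℤ) : R →+ R := if 0 ≤ z then GradedRing.proj 𝒜 z.toNat else 0

theorem ringProj_same {z : ℤ} {j : ℕ} (h : z = j) {r : R} (hr : r ∈ 𝒜 j) :
    ringProj 𝒜 z r = r := by
  subst h
  simpa [ringProj] using DirectSum.decompose_of_mem_same 𝒜 hr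

theorem ringProj_ne {z : ℤ} {j : ℕ} (h : z ≠ j) {r : R} (hr : r ∈ 𝒜 j) :
    ringProj 𝒜 z r = 0 := by
  unfold ringProj
  split_ifs with hz
  · exact DirectSum.decompose_of_mem_ne 𝒜 hr (by omega)
  · rfl

/-- Families of additive maps `R → ℚ/ℤ`, indexed by `ℤ × X`. -/
abbrev CoAmb (R : Type u) [CommRing R] (X : Type v) : Type (max u v) := ℤ → X → CharacterModule R

/-- The families `φ` such that `φ n χ` lives on the component of `R` of degree `n - k`. -/
def coDeg (X : Type v) (k : ℤ) : AddSubgroup (CoAmb R X) where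
  carrier := {φ | ∀ (n : ℤ) (j : ℕ) (r : R), r ∈ 𝒜 j → n ≠ j + k → ∀ χ, φ n χ r = 0}
  zero_mem' := fun _ _ _ _ _ _ => rfl
  add_mem' := by
    intro φ ψ hφ hψ n j r hr hn χ
    exact (congrArg₂ (· + ·) (hφ n j r hr hn χ) (hψ n j r hr hn χ)).trans (add_zero 0)
  neg_mem' := by
    intro φ hφ n j r hr hn χ
    exact (congrArg Neg.neg (hφ n j r hr hn χ)).trans neg_zero

theorem coDeg_smul (X : Type v) {i : ℕ} {s : R} (hs : s ∈ 𝒜 i) {k : ℤ} {φ : CoAmb R X}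
    (hφ : φ ∈ coDeg 𝒜 X k) : s • φ ∈ coDeg 𝒜 X (i + k) := by
  intro n j r hr hn χ
  refine hφ n (i + j) (s * r) (SetLike.GradedMul.mul_mem hs hr) ?_ χ
  push_cast
  omega

/-- The sum of the `coDeg k`, an `R`-submodule. -/
def coSub (X : Type v) : Submodule R (CoAmb R X) where
  __ := ⨆ k, coDeg 𝒜 X k
  smul_mem' := by
    intro s φ hφ
    change φ ∈ ⨆ k, coDeg 𝒜 X k at hφ
    change s • φ ∈ ⨆ k, coDeg 𝒜 X k
    refine AddSubgroup.iSup_induction _ (C := fun φ => s • φ ∈ ⨆ k, coDeg 𝒜 X k) hφ ?_ ?_ ?_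
    · intro k ψ hψ
      refine DirectSum.Decomposition.inductionOn 𝒜
        (motive := fun s => s • ψ ∈ ⨆ k, coDeg 𝒜 X k) ?_ ?_ ?_ s
      · rw [zero_smul]; exact zero_mem _
      · intro i t
        exact AddSubgroup.mem_iSup_of_mem _ (coDeg_smul 𝒜 X t.2 hψ)
      · intro a b ha hb
        rw [add_smul]; exact add_mem ha hb
    · rw [smul_zero]; exact zero_mem _
    · intro a b ha hb
      rw [smul_add]; exact add_mem ha hb

theorem mem_coSub {X : Type v} {φ : CoAmb R X} :
    φ ∈ coSub 𝒜 X ↔ φ ∈ ⨆ k, coDeg 𝒜 X k := Iff.rfl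

/-- The projection onto `coDeg k`. -/
def coProj (X : Type v) (k : ℤ) : CoAmb R X →+ CoAmb R X where
  toFun φ n χ := AddMonoidHom.comp (φ n χ : R →+ AddCircle (1 : ℚ)) (ringProj 𝒜 (n - k))
  map_zero' := rfl
  map_add' _ _ := rfl

theorem coProj_apply (X : Type v) (k : ℤ) (φ : CoAmb R X) (n : ℤ) (χ : X) (r : R) :
    coProj 𝒜 X k φ n χ r = φ n χ (ringProj 𝒜 (n - k) r) := rfl

/-- Two families agree if they agree on homogeneous elements of `R`. -/
theorem coAmb_ext {X : Type v} {φ ψ : CoAmb R X}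
    (h : ∀ (n : ℤ) (χ : X) (j : ℕ) (r : R), r ∈ 𝒜 j → φ n χ r = ψ n χ r) : φ = ψ := by
  funext n χ
  refine CharacterModule.ext _ fun r => ?_
  refine DirectSum.Decomposition.inductionOn 𝒜 (motive := fun r => φ n χ r = ψ n χ r) ?_ ?_ ?_ r
  · rw [map_zero, map_zero]
  · intro i t
    exact h n χ i t t.2
  · intro a b ha hb
    rw [map_add, map_add, ha, hb]

theorem coProj_same {X : Type v} {k : ℤ} {φ : CoAmb R X} (hφ : φ ∈ coDeg 𝒜 X k) :
    coProj 𝒜 X k φ = φ := by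
  refine coAmb_ext 𝒜 fun n χ j r hr => ?_
  rw [coProj_apply]
  by_cases h : n = j + k
  · rw [ringProj_same 𝒜 (by omega) hr]
  · rw [ringProj_ne 𝒜 (by omega) hr, map_zero, hφ n j r hr h χ]

theorem coProj_ne {X : Type v} {m k : ℤ} (hmk : m ≠ k) {φ : CoAmb R X}
    (hφ : φ ∈ coDeg 𝒜 X m) : coProj 𝒜 X k φ = 0 := by
  refine coAmb_ext 𝒜 fun n χ j r hr => ?_
  rw [coProj_apply]
  by_cases h : n = j + k
  · rw [ringProj_same 𝒜 (by omega) hr]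
    exact hφ n j r hr (by omega) χ
  · rw [ringProj_ne 𝒜 (by omega) hr, map_zero]
    rfl

theorem coProj_mem {X : Type v} (k : ℤ) (φ : CoAmb R X) :
    coProj 𝒜 X k φ ∈ coDeg 𝒜 X k := by
  intro n j r hr hn χ
  rw [coProj_apply, ringProj_ne 𝒜 (by omega) hr, map_zero]

/-- A cofree graded module. -/
def cofree (X : Type v) : GrMod.{u, max u v} 𝒜 where
  carrier := coSub 𝒜 X
  deg k := (coDeg 𝒜 X k).comap (coSub 𝒜 X).subtype.toAddMonoidHom
  decomposition := decompositionOfProj _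
    (fun k => ((coProj 𝒜 X k).comp (coSub 𝒜 X).subtype.toAddMonoidHom).codRestrict
      (coSub 𝒜 X).toAddSubgroup
      (fun x => AddSubgroup.mem_iSup_of_mem k (coProj_mem 𝒜 k x.1)))
    (fun _ _ hx => Subtype.ext (coProj_same 𝒜 hx))
    (fun _ _ h _ hx => Subtype.ext (coProj_ne 𝒜 h hx))
    (fun x => by
      obtain ⟨x, hx⟩ := x
      refine AddSubgroup.iSup_induction' (coDeg 𝒜 X)
        (C := fun x hx => (⟨x, hx⟩ : coSub 𝒜 X) ∈
          ⨆ k, (coDeg 𝒜 X k).comap (coSub 𝒜 X).subtype.toAddMonoidHom) ?_ ?_ ?_ hx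
      · intro k y hy
        exact AddSubgroup.mem_iSup_of_mem k hy
      · exact zero_mem _
      · intro a b _ _ ha hb
        exact add_mem ha hb)
  smul_mem i _ _ x hr hx := coDeg_smul 𝒜 X (i := i) hr hx

/-- The homogeneous homomorphism `N → cofree X` given by a family of characters of `N`. -/
def toCofree {X : Type v} (N : GrMod.{u, w} 𝒜) (δ : X → N →+ AddCircle (1 : ℚ)) :
    N →ₗ[R] cofree 𝒜 X :=
  LinearMap.codRestrict (coSub 𝒜 X)
    { toFun := fun y n χ =>
        ((δ χ).comp (N.proj n)).comp ((LinearMap.toSpanSingleton R N y).toAddMonoidHom)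
      map_add' := by
        intro y z
        funext n χ
        refine CharacterModule.ext _ fun r => ?_
        change δ χ (N.proj n (r • (y + z))) =
          δ χ (N.proj n (r • y)) + δ χ (N.proj n (r • z))
        rw [smul_add, map_add, map_add]
      map_smul' := by
        intro s y
        funext n χ
        refine CharacterModule.ext _ fun r => ?_
        change δ χ (N.proj n (r • s • y)) = δ χ (N.proj n ((s * r) • y))
        rw [smul_smul, mul_comm] }
    (by
      intro y
      rw [mem_coSub]
      obtain ⟨s, hs⟩ := N.sum_proj y
      rw [← hs, map_sum]
      refine sum_mem fun k _ => AddSubgroup.mem_iSup_of_mem k ?_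
      intro n j r hr hn χ
      change δ χ (N.proj n (r • N.proj k y)) = 0
      rw [N.proj_ne (N.smul_mem j k r _ hr (N.proj_mem k y)) (Ne.symm hn), map_zero])

theorem toCofree_apply {X : Type v} (N : GrMod.{u, w} 𝒜) (δ : X → N →+ AddCircle (1 : ℚ))
    (y : N) (n : ℤ) (χ : X) (r : R) :
    (toCofree 𝒜 N δ y).1 n χ r = δ χ (N.proj n (r • y)) := rfl

theorem toCofree_graded {X : Type v} (N : GrMod.{u, w} 𝒜) (δ : X → N →+ AddCircle (1 : ℚ)) :
    IsGradedHom (toCofree 𝒜 N δ) := by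
  intro k y hy n j r hr hn χ
  change δ χ (N.proj n (r • y)) = 0
  rw [N.proj_ne (N.smul_mem j k r _ hr hy) (Ne.symm hn), map_zero]

theorem cofree_injective (X : Type v) : (cofree 𝒜 X).IsGrInjective := by
  intro L N j g hj hji hg
  -- the additive maps `l ↦ ∑ₙ g(lₙ)(1)` in degree `n`
  have hγ : ∀ χ : X, ∃ γ : L →+ AddCircle (1 : ℚ), ∀ (n : ℤ) (l : L), l ∈ L.deg n →
      γ l = (g l).1 n χ 1 := by
    intro χ
    let ev : ∀ n : ℤ, L.deg n →+ AddCircle (1 : ℚ) := fun n =>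
      { toFun := fun l => (g l.1).1 n χ 1
        map_zero' := by
          change (g (0 : L)).1 n χ 1 = 0
          rw [map_zero]; rfl
        map_add' := by
          intro a b
          change (g (a.1 + b.1 : L)).1 n χ 1 = _
          rw [map_add]; rfl }
    refine ⟨(DirectSum.toAddMonoid ev).comp
      (DirectSum.decomposeAddEquiv L.deg).toAddMonoidHom, fun n l hl => ?_⟩
    change DirectSum.toAddMonoid ev (DirectSum.decompose L.deg l) = _
    rw [DirectSum.decompose_of_mem L.deg hl, DirectSum.toAddMonoid_of]
    rfl
  choose γ hγ using hγ
  have hδ : ∀ χ, ∃ δ : N →+ AddCircle (1 : ℚ), δ.comp j.toAddMonoidHom = γ χ := fun χ =>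
    (Module.Baer.of_divisible _).extension_property_addMonoidHom _ hji (γ χ)
  choose δ hδ using hδ
  refine ⟨toCofree 𝒜 N δ, toCofree_graded 𝒜 N δ, ?_⟩
  have hom : ∀ (k : ℤ) (l : L), l ∈ L.deg k → toCofree 𝒜 N δ (j l) = g l := by
    intro k l hl
    refine Subtype.ext (coAmb_ext 𝒜 fun n χ i r hr => ?_)
    rw [toCofree_apply, ← map_smul]
    have hrl := L.smul_mem i k r l hr hl
    by_cases h : n = i + k
    · subst h
      rw [N.proj_same (hj _ _ hrl)]
      have h1 : δ χ (j (r • l)) = γ χ (r • l) := DFunLike.congr_fun (hδ χ) (r • l)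
      rw [h1, hγ χ _ _ hrl, map_smul]
      change (g l).1 (i + k) χ (r * 1) = _
      rw [mul_one]
    · rw [N.proj_ne (hj _ _ hrl) (Ne.symm h), map_zero]
      exact ((hg k l hl) n i r hr h χ).symm
  intro l
  obtain ⟨s, hs⟩ := L.sum_proj l
  rw [← hs]
  simp only [map_sum]
  exact Finset.sum_congr rfl fun n _ => hom n _ (L.proj_mem n l)

variable {𝒜}

/-- An embedding of `M` into a graded injective. -/
def hull (M : GrMod.{u, v} 𝒜) : GrMod.{u, max u v} 𝒜 := cofree 𝒜 (M →+ AddCircle (1 : ℚ))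

def toHull (M : GrMod.{u, v} 𝒜) : M →ₗ[R] M.hull := toCofree 𝒜 M fun χ => χ

theorem toHull_injective (M : GrMod.{u, v} 𝒜) : Function.Injective M.toHull := by
  rw [injective_iff_map_eq_zero]
  intro x hx
  refine M.eq_of_proj fun n => CharacterModule.eq_zero_of_character_apply fun c => ?_
  have h := toCofree_apply 𝒜 M (fun χ => χ) x n (c : M →+ AddCircle (1 : ℚ)) 1
  rw [one_smul] at h
  refine h.symm.trans ?_
  change (M.toHull x).1 n c 1 = 0
  rw [hx]
  rfl

theorem toHull_range (M : GrMod.{u, v} 𝒜) :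
    M.hull.IsHomogeneousSub (LinearMap.range M.toHull) := by
  rintro _ ⟨x, rfl⟩ n
  exact ⟨M.proj n x, ((toCofree_graded 𝒜 M _).proj n x).symm⟩

/-- The cokernel of the embedding into a graded injective. -/
def cosyz (M : GrMod.{u, v} 𝒜) : GrMod.{u, max u v} 𝒜 := M.hull.quot _ M.toHull_range

def toCosyz (M : GrMod.{u, v} 𝒜) : M.hull →ₗ[R] M.cosyz := (LinearMap.range M.toHull).mkQ

def cosyzIter (M : GrMod.{u, v} 𝒜) : ℕ → GrMod.{u, max u v} 𝒜
  | 0 => M.cosyz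
  | n + 1 => (cosyzIter M n).cosyz

def resTerm (M : GrMod.{u, v} 𝒜) : ℕ → GrMod.{u, max u v} 𝒜
  | 0 => M.hull
  | n + 1 => (cosyzIter M n).hull

/-- The surjections from the terms of the resolution to the cosyzygies. -/
def resProj (M : GrMod.{u, v} 𝒜) : ∀ n, resTerm M n →ₗ[R] cosyzIter M n
  | 0 => M.toCosyz
  | n + 1 => (cosyzIter M n).toCosyz

theorem resProj_surjective (M : GrMod.{u, v} 𝒜) :
    ∀ n, Function.Surjective (resProj M n)
  | 0 => Submodule.mkQ_surjective _
  | _ + 1 => Submodule.mkQ_surjective _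

theorem resProj_graded (M : GrMod.{u, v} 𝒜) : ∀ n, IsGradedHom (resProj M n)
  | 0 => fun _ x hx => ⟨x, hx, rfl⟩
  | _ + 1 => fun _ x hx => ⟨x, hx, rfl⟩

theorem ker_resProj_succ (M : GrMod.{u, v} 𝒜) (n : ℕ) :
    LinearMap.ker (resProj M (n + 1)) = LinearMap.range (cosyzIter M n).toHull :=
  Submodule.ker_mkQ _

theorem ker_toHull_comp (M : GrMod.{u, v} 𝒜) {P : Type w} [AddCommGroup P] [Module R P]
    (q : P →ₗ[R] M) : LinearMap.ker (M.toHull ∘ₗ q) = LinearMap.ker q := by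
  ext x
  simp only [LinearMap.mem_ker, LinearMap.comp_apply]
  exact map_eq_zero_iff _ M.toHull_injective

/-- There are enough graded injectives: a resolution by cofree graded modules. -/
theorem nonempty_injRes (M : GrMod.{u, v} 𝒜) : Nonempty (InjRes M) :=
  ⟨{ E := resTerm M
     d := fun i => (cosyzIter M i).toHull ∘ₗ resProj M i
     ε := M.toHull
     injective := fun i => by cases i <;> exact cofree_injective 𝒜 _
     graded_d := fun i n x hx =>
       toCofree_graded 𝒜 (cosyzIter M i) _ n _ (resProj_graded M i n x hx)
     graded_ε := toCofree_graded 𝒜 M _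
     ε_injective := M.toHull_injective
     exact_zero := by
       refine Eq.trans ?_ (ker_toHull_comp (cosyzIter M 0) (resProj M 0)).symm
       exact (Submodule.ker_mkQ _).symm
     exact_succ := fun i => by
       refine Eq.trans ?_ (ker_toHull_comp (cosyzIter M (i + 1)) (resProj M (i + 1))).symm
       refine Eq.trans ?_ (ker_resProj_succ M i).symm
       exact LinearMap.range_comp_of_range_eq_top _
         (LinearMap.range_eq_top.mpr (resProj_surjective M i)) }⟩

end enough

section localCohomology

variable {R : Type u} [CommRing R] {𝒜 : ℕ → AddSubgroup R} [GradedRing 𝒜]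

/-- The `𝔞`-torsion submodule `Γ_𝔞(M) = {x | 𝔞ᵏ x = 0 for some k}`. -/
def Γ (a : Ideal R) (M : Type v) [AddCommGroup M] [Module R M] : Submodule R M where
  carrier := {x | ∃ k : ℕ, ∀ r ∈ a ^ k, r • x = 0}
  zero_mem' := ⟨0, fun r _ => smul_zero r⟩
  add_mem' := by
    rintro x y ⟨k, hk⟩ ⟨l, hl⟩
    refine ⟨k + l, fun r hr => ?_⟩
    rw [smul_add, hk r (Ideal.pow_le_pow_right (Nat.le_add_right k l) hr),
      hl r (Ideal.pow_le_pow_right (Nat.le_add_left l k) hr), add_zero]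
  smul_mem' := by
    rintro s x ⟨k, hk⟩
    exact ⟨k, fun r hr => by rw [smul_comm, hk r hr, smul_zero]⟩

theorem pow_homogeneous (a : HomogeneousIdeal 𝒜) (k : ℕ) :
    (a.toIdeal ^ k).IsHomogeneous 𝒜 := by
  induction k with
  | zero =>
    rw [pow_zero, Ideal.one_eq_top]
    exact Ideal.IsHomogeneous.top 𝒜
  | succ k ih =>
    rw [pow_succ]
    exact ih.mul a.isHomogeneous

theorem Γ_homogeneous (a : HomogeneousIdeal 𝒜) (M : GrMod.{u, v} 𝒜) :
    M.IsHomogeneousSub (Γ a.toIdeal M) := by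
  classical
  rintro x ⟨k, hk⟩ n
  refine ⟨k, fun r hr => ?_⟩
  rw [← DirectSum.sum_support_decompose 𝒜 r, Finset.sum_smul]
  refine Finset.sum_eq_zero fun i _ => ?_
  rw [← M.proj_smul (DirectSum.decompose 𝒜 r i).2,
    hk _ (pow_homogeneous a k i hr), map_zero]

namespace InjRes

variable {M : GrMod.{u, v} 𝒜} (I : InjRes M) (a : HomogeneousIdeal 𝒜)

/-- The cocycles of `Γ_𝔞(E⁰) → Γ_𝔞(E¹) → ⋯` in `Γ_𝔞(Eⁱ)`. -/
def cocycles (i : ℕ) : Submodule R (I.E i) := Γ a.toIdeal (I.E i) ⊓ LinearMap.ker (I.d i)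

/-- The coboundaries of `Γ_𝔞(E⁰) → Γ_𝔞(E¹) → ⋯` in `Γ_𝔞(Eⁱ)`. -/
def coboundaries : ∀ i : ℕ, Submodule R (I.E i)
  | 0 => ⊥
  | i + 1 => (Γ a.toIdeal (I.E i)).map (I.d i)

theorem cocycles_homogeneous (i : ℕ) : (I.E i).IsHomogeneousSub (I.cocycles a i) := by
  rintro x ⟨hx, hx'⟩ n
  refine ⟨Γ_homogeneous a _ x hx n, ?_⟩
  rw [SetLike.mem_coe, LinearMap.mem_ker] at hx' ⊢
  rw [← (I.graded_d i).proj, hx', map_zero]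

theorem coboundaries_homogeneous (i : ℕ) :
    (I.E i).IsHomogeneousSub (I.coboundaries a i) := by
  cases i with
  | zero =>
    intro x hx n
    rw [(Submodule.mem_bot R).mp hx, map_zero]
    exact zero_mem _
  | succ i =>
    rintro _ ⟨x, hx, rfl⟩ n
    exact ⟨_, Γ_homogeneous a _ x hx n, ((I.graded_d i).proj n x).symm⟩

/-- The graded cohomology module `Hⁱ(Γ_𝔞(E^•)) = cocycles / coboundaries`. -/
def cohomology (i : ℕ) : GrMod.{u, max u v} 𝒜 :=
  ((I.E i).sub (I.cocycles a i) (I.cocycles_homogeneous a i)).quot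
    ((I.coboundaries a i).comap (I.cocycles a i).subtype)
    (fun x hx n => by
      have h : ((I.E i).sub _ (I.cocycles_homogeneous a i)).proj n x =
          ⟨(I.E i).proj n x.1, I.cocycles_homogeneous a i x.1 x.2 n⟩ :=
        Subtype.ext (sub_proj (I.E i) _ (I.cocycles_homogeneous a i) n x)
      rw [h]
      exact I.coboundaries_homogeneous a i x.1 hx n)

end InjRes

/-- The `i`-th graded local cohomology module `Hⁱ_𝔞(M)`: the `i`-th right derived functor of
`Γ_𝔞` on the category of graded modules, `Hⁱ(Γ_𝔞(E^•))` for a graded injective resolution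
`E^•` of `M`. -/
def H (a : HomogeneousIdeal 𝒜) (i : ℕ) (M : GrMod.{u, v} 𝒜) : GrMod.{u, max u v} 𝒜 :=
  (Classical.choice (nonempty_injRes M)).cohomology a i

/-- `f_𝔞^𝔟(M) = sup {k | 𝔟 ⊆ √(0 : Hⁱ_𝔞(M)) for all i < k}`, an element of `ℕ ∪ {∞}`. -/
def finitenessDim (a b : HomogeneousIdeal 𝒜) (M : GrMod.{u, v} 𝒜) : ℕ∞ :=
  ⨆ (k : ℕ) (_ : ∀ i < k, b.toIdeal ≤ (Module.annihilator R (H a i M)).radical), (k : ℕ∞)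

end localCohomology

end

end GrMod

/-- `R = ⨁ 𝒜 i` is a standard graded Noetherian ring: `R₀` is Noetherian and `R` is generated as
an `R₀`-algebra by finitely many elements of degree one. -/
def IsStandardGraded {R : Type u} [CommRing R] (𝒜 : ℕ → AddSubgroup R) [GradedRing 𝒜] : Prop :=
  IsNoetherianRing (𝒜 0) ∧
    ∃ s : Finset R, (s : Set R) ⊆ 𝒜 1 ∧ Algebra.adjoin (𝒜 0) (s : Set R) = ⊤

/-! Fix a graded injective resolution `E` of `M`, write Hⁱ for the cohomology of Γ_𝔞(E), and call
socle the elements killed by R₊. "Almost all degrees" means all but finitely many, the filter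
`cofinite`.

The central claim is `eventually_mem_coboundaries`: if Hⁱ vanishes in almost all degrees for every i
< f, then H^f has zero socle in almost all degrees. It is used twice. For i < f some power of R₊
kills Hⁱ, and a module killed by a power of R₊ whose socle vanishes in almost all degrees vanishes
itself in almost all degrees; strong induction on i thus supplies the premise of the claim. At f, if
the component of degree n+1 is zero, then the component of degree n is killed by the generators of
degree one, so it is socle and, for almost all n, zero. Hence nonvanishing passes from n to n+1 with
finitely many exceptions, which leaves room for finitely many jumps only.

The claim rests on three facts. The modules Extⁱ(R/R₊, M) are finitely generated and killed by R₊,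
so they live in finitely many degrees: the socles of `E` form an exact complex in almost all degrees
(`eventually_socle_exact`). In a fixed degree these socles are injective R₀-modules
(`Extends.baer_socle`), so this exact complex splits over R₀ (`Module.Baer.exists_section`); since R
acts on socles through R₀, the splitting preserves 𝔞-torsion, and the socles of Γ_𝔞(E) are exact in
almost all degrees as well (`eventually_torsion_socle_exact`). Finally, by Artin–Rees the terms of
Γ_𝔞(E) stay injective with respect to finitely generated graded modules (`Extends.torsion`), and a
diagram chase (`eventually_no_socle`) replaces a socle class of H^f by a cocycle that is itself
killed by R₊. -/

namespace GrMod

open Filter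

noncomputable section

/-! ### Homomorphisms of degree n and injectivity with respect to finitely generated graded modules
-/

section degree

variable {R : Type u} [CommRing R] {𝒜 : ℕ → AddSubgroup R}

theorem induction_homogeneous (M : GrMod.{u, v} 𝒜) {p : M → Prop} (x : M) (zero : p 0)
    (add : ∀ x y, p x → p y → p (x + y)) (hom : ∀ m, ∀ x ∈ M.deg m, p x) : p x := by
  obtain ⟨s, hs⟩ := M.sum_proj x
  rw [← hs]
  exact Finset.sum_induction _ p add zero fun n _ => hom n _ (M.proj_mem n x)

/-- Homogeneous homomorphisms of degree `n`. -/
def IsDegHom (n : ℤ) {M : GrMod.{u, v} 𝒜} {N : GrMod.{u, w} 𝒜} (f : M →ₗ[R] N) : Prop :=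
  ∀ (m : ℤ) (x : M), x ∈ M.deg m → f x ∈ N.deg (m + n)

variable {L : GrMod.{u, v} 𝒜} {M : GrMod.{u, v} 𝒜} {N : GrMod.{u, w} 𝒜}

theorem IsDegHom.sub {n : ℤ} {f g : M →ₗ[R] N} (hf : IsDegHom n f) (hg : IsDegHom n g) :
    IsDegHom n (f - g) := fun m x hx => sub_mem (hf m x hx) (hg m x hx)

theorem IsDegHom.comp {n : ℤ} {g : M →ₗ[R] N} {f : L →ₗ[R] M} (hg : IsDegHom n g)
    (hf : IsGradedHom f) : IsDegHom n (g ∘ₗ f) := fun m x hx => hg m _ (hf m x hx)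

theorem IsGradedHom.comp_isDegHom {P : GrMod.{u, w} 𝒜} {n : ℤ} {g : N →ₗ[R] P} {f : M →ₗ[R] N}
    (hg : IsGradedHom g) (hf : IsDegHom n f) : IsDegHom n (g ∘ₗ f) :=
  fun m x hx => hg _ _ (hf m x hx)

theorem IsGradedHom.ker {f : M →ₗ[R] N} (hf : IsGradedHom f) :
    M.IsHomogeneousSub (LinearMap.ker f) := by
  intro x hx n
  rw [LinearMap.mem_ker] at hx ⊢
  rw [← hf.proj, hx, map_zero]

theorem IsGradedHom.range {f : M →ₗ[R] N} (hf : IsGradedHom f) :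
    N.IsHomogeneousSub (LinearMap.range f) := by
  rintro _ ⟨x, rfl⟩ n
  exact ⟨M.proj n x, (hf.proj n x).symm⟩

/-- The shifted module `M(n)`. -/
def shift (M : GrMod.{u, v} 𝒜) (n : ℤ) : GrMod.{u, v} 𝒜 where
  carrier := M
  deg m := M.deg (m + n)
  decomposition := decompositionOfProj _ (fun m => M.proj (m + n))
    (fun _ _ hx => M.proj_same hx)
    (fun _ _ h _ hx => M.proj_ne hx (by omega))
    (fun x => by
      obtain ⟨s, hs⟩ := M.sum_proj x
      rw [← hs]
      refine sum_mem fun m _ => AddSubgroup.mem_iSup_of_mem (m - n) ?_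
      rw [sub_add_cancel]
      exact M.proj_mem m x)
  smul_mem i m r x hr hx := by
    rw [add_assoc]
    exact M.smul_mem i (m + n) r x hr hx

/-- The graded module `0`. -/
def zeroModule (𝒜 : ℕ → AddSubgroup R) : GrMod.{u, v} 𝒜 where
  carrier := PUnit
  deg _ := ⊥
  decomposition := decompositionOfProj _ (fun _ => 0) (fun _ _ _ => rfl) (fun _ _ _ _ _ => rfl)
    (fun _ => zero_mem _)
  smul_mem _ _ _ _ _ _ := rfl

/-- `G` is injective with respect to finitely generated graded modules: a homomorphism
`F → G` of degree `n` that kills the kernel of `π : F → N` factors through `π`. -/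
def Extends (G : GrMod.{u, v} 𝒜) : Prop :=
  ∀ (F N : GrMod.{u, v} 𝒜) [Module.Finite R F] [Module.Finite R N] (π : F →ₗ[R] N),
    IsGradedHom π → ∀ (n : ℤ) (ψ : F →ₗ[R] G), IsDegHom n ψ →
      LinearMap.ker π ≤ LinearMap.ker ψ → ∃ χ : N →ₗ[R] G, IsDegHom n χ ∧ χ ∘ₗ π = ψ

theorem exists_comp_rangeRestrict {A B C : Type*} [AddCommGroup A] [AddCommGroup B]
    [AddCommGroup C] [Module R A] [Module R B] [Module R C] (π : A →ₗ[R] B) (ψ : A →ₗ[R] C)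
    (h : LinearMap.ker π ≤ LinearMap.ker ψ) :
    ∃ g : LinearMap.range π →ₗ[R] C, g ∘ₗ π.rangeRestrict = ψ := by
  refine ⟨(LinearMap.ker π).liftQ ψ h ∘ₗ π.quotKerEquivRange.symm.toLinearMap, ?_⟩
  ext x
  have : π.rangeRestrict x = π.quotKerEquivRange (Submodule.Quotient.mk x) := rfl
  simp [this]

/-- The map descends to the image of `π`, and graded injectivity extends it from there. Twisting
source and target by -n turns degree n into degree 0. -/
theorem IsGrInjective.extends {E : GrMod.{u, v} 𝒜} (hE : E.IsGrInjective) : E.Extends := by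
  intro F N _ _ π hπ n ψ hψ hker
  obtain ⟨g, hg⟩ := exists_comp_rangeRestrict π ψ hker
  obtain ⟨χ, hχ, hχg⟩ := hE ((N.sub (LinearMap.range π) hπ.range).shift (-n)) (N.shift (-n))
    (LinearMap.range π).subtype g (fun m x hx => hx) Subtype.val_injective (by
      rintro m ⟨_, x, rfl⟩ hx
      change π x ∈ N.deg (m + -n) at hx
      have h1 : (⟨π x, x, rfl⟩ : LinearMap.range π) =
          π.rangeRestrict (F.proj (m + -n) x) := Subtype.ext (by
        change π x = π _
        rw [← hπ.proj, N.proj_same hx])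
      have h2 : g ⟨π x, x, rfl⟩ = ψ (F.proj (m + -n) x) := by rw [← hg, h1]; rfl
      have h3 := hψ _ _ (F.proj_mem (m + -n) x)
      rw [neg_add_cancel_right] at h3
      exact h2 ▸ h3)
  refine ⟨χ, fun m x hx => ?_, ?_⟩
  · refine hχ (m + n) x ?_
    change x ∈ N.deg (m + n + -n)
    rwa [add_neg_cancel_right]
  · rw [← hg]
    ext x
    exact hχg (π.rangeRestrict x)

theorem exists_homogeneous_generators (T : GrMod.{u, v} 𝒜) [Module.Finite R T] :
    ∃ s : Finset T, (∀ t ∈ s, ∃ m, t ∈ T.deg m) ∧ Submodule.span R (s : Set T) = ⊤ := by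
  classical
  obtain ⟨s, hs⟩ := Module.Finite.fg_top (R := R) (M := T)
  choose e he using T.sum_proj
  refine ⟨s.biUnion fun t => (e t).image fun n => T.proj n t, ?_, ?_⟩
  · intro t ht
    simp only [Finset.mem_biUnion, Finset.mem_image] at ht
    obtain ⟨t', -, n, -, rfl⟩ := ht
    exact ⟨n, T.proj_mem n t'⟩
  · rw [eq_top_iff, ← hs, Submodule.span_le]
    intro t ht
    rw [← he t]
    refine sum_mem fun n hn => Submodule.subset_span ?_
    simp only [Finset.mem_coe, Finset.mem_biUnion, Finset.mem_image]
    exact ⟨t, ht, n, hn, rfl⟩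

end degree

/-! ### Homogeneous components of linear maps, and torsion submodules of injectives -/

section graded

variable {R : Type u} [CommRing R] {𝒜 : ℕ → AddSubgroup R} [GradedRing 𝒜]

theorem ring_induction (𝒜 : ℕ → AddSubgroup R) [GradedRing 𝒜] {p : R → Prop} (r : R)
    (zero : p 0) (add : ∀ x y, p x → p y → p (x + y)) (hom : ∀ i, ∀ x ∈ 𝒜 i, p x) : p r :=
  DirectSum.Decomposition.inductionOn 𝒜 zero (fun {i} x => hom i x x.2) (fun x y => add x y) r

/-- The homogeneous component of degree `n` of a linear map. -/
def homComponent {M : GrMod.{u, v} 𝒜} {N : GrMod.{u, w} 𝒜} (n : ℤ) (f : M →ₗ[R] N) :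
    M →ₗ[R] N :=
  let g : M →+ N := (DirectSum.toAddMonoid fun m =>
    ((N.proj (m + n)).comp f.toAddMonoidHom).comp (M.deg m).subtype).comp
      (DirectSum.decomposeAddEquiv M.deg).toAddMonoidHom
  have hg : ∀ m, ∀ x ∈ M.deg m, g x = N.proj (m + n) (f x) := fun m x hx => by
    change DirectSum.toAddMonoid _ (DirectSum.decompose M.deg x) = _
    rw [DirectSum.decompose_of_mem M.deg hx, DirectSum.toAddMonoid_of]
    rfl
  { g with
    map_smul' := fun r x => by
      change g (r • x) = r • g x
      refine ring_induction 𝒜 (p := fun r => g (r • x) = r • g x) r (by simp) ?_ ?_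
      · intro a b ha hb
        rw [add_smul, map_add, ha, hb, add_smul]
      · intro i r hr
        refine M.induction_homogeneous (p := fun x => g (r • x) = r • g x) x (by simp) ?_ ?_
        · intro a b ha hb
          rw [smul_add, map_add, ha, hb, map_add, smul_add]
        · intro m x hx
          rw [hg _ _ hx, hg _ _ (M.smul_mem i m r x hr hx), map_smul, add_assoc,
            N.proj_smul hr] }

variable {M : GrMod.{u, v} 𝒜} {N : GrMod.{u, w} 𝒜}

theorem homComponent_apply {n m : ℤ} (f : M →ₗ[R] N) {x : M} (hx : x ∈ M.deg m) :
    homComponent n f x = N.proj (m + n) (f x) := by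
  change DirectSum.toAddMonoid _ (DirectSum.decompose M.deg x) = _
  rw [DirectSum.decompose_of_mem M.deg hx, DirectSum.toAddMonoid_of]
  rfl

theorem homComponent_isDegHom (n : ℤ) (f : M →ₗ[R] N) : IsDegHom n (homComponent n f) := by
  intro m x hx
  rw [homComponent_apply f hx]
  exact N.proj_mem _ _

/-- A linear map on a finitely generated module is the sum of its homogeneous components. -/
theorem exists_sum_homComponent [Module.Finite R M] (f : M →ₗ[R] N) :
    ∃ s : Finset ℤ, ∑ n ∈ s, homComponent n f = f := by
  classical
  obtain ⟨g, hg, hgt⟩ := M.exists_homogeneous_generators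
  choose e he using N.sum_proj
  choose! d hd using hg
  -- A component of degree k of the value at a generator of degree `d t` comes from the part of `f`
  -- of degree k - `d t`.
  let s := g.biUnion fun t => (e (f t)).image fun k => k - d t
  refine ⟨s, LinearMap.ext_on hgt fun t ht => ?_⟩
  rw [LinearMap.sum_apply]
  conv_rhs => rw [← he (f t)]
  have h1 : ∀ n, homComponent n f t = N.proj (d t + n) (f t) := fun n =>
    homComponent_apply f (hd t ht)
  simp only [h1]
  have h2 : ∑ n ∈ s, N.proj (d t + n) (f t) =
      ∑ k ∈ s.image fun n => d t + n, N.proj k (f t) := by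
    rw [Finset.sum_image]
    intro a _ b _ h
    exact add_left_cancel h
  rw [h2]
  symm
  refine Finset.sum_subset ?_ ?_
  · intro k hk
    rw [Finset.mem_image]
    refine ⟨k - d t, ?_, by ring⟩
    exact Finset.mem_biUnion.mpr ⟨t, ht, Finset.mem_image.mpr ⟨k, hk, rfl⟩⟩
  · intro k _ hk
    have h3 : N.proj k (f t) = N.proj k (∑ m ∈ e (f t), N.proj m (f t)) := by rw [he]
    rw [h3, map_sum]
    refine Finset.sum_eq_zero fun m hm => N.proj_ne (N.proj_mem m _) ?_
    rintro rfl
    exact hk hm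

/-- The factorization property for linear maps that need not be homogeneous. -/
theorem Extends.exists_comp_eq {G F N : GrMod.{u, v} 𝒜} (hG : G.Extends) [Module.Finite R F]
    [Module.Finite R N] {π : F →ₗ[R] N} (hπ : IsGradedHom π) {ψ : F →ₗ[R] G}
    (hker : LinearMap.ker π ≤ LinearMap.ker ψ) : ∃ χ : N →ₗ[R] G, χ ∘ₗ π = ψ := by
  obtain ⟨s, hs⟩ := exists_sum_homComponent ψ
  have h : ∀ n, ∃ χ : N →ₗ[R] G, χ ∘ₗ π = homComponent n ψ := by
    intro n
    -- As `ker π` is homogeneous, each component of `ψ` kills it too.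
    obtain ⟨χ, -, h⟩ := hG F N π hπ n (homComponent n ψ) (homComponent_isDegHom n ψ) (by
      intro x hx
      obtain ⟨t, ht⟩ := F.sum_proj x
      rw [LinearMap.mem_ker, ← ht, map_sum]
      refine Finset.sum_eq_zero fun m _ => ?_
      rw [homComponent_apply ψ (F.proj_mem m x), LinearMap.mem_ker.mp (hker (hπ.ker x hx m)),
        map_zero])
    exact ⟨χ, h⟩
  choose χ hχ using h
  refine ⟨∑ n ∈ s, χ n, ?_⟩
  rw [← hs]
  ext x
  simp only [LinearMap.comp_apply, LinearMap.sum_apply]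
  exact Finset.sum_congr rfl fun n _ => DFunLike.congr_fun (hχ n) x

theorem isHomogeneousSub_smul_top {a : Ideal R} (ha : a.IsHomogeneous 𝒜) (N : GrMod.{u, v} 𝒜) :
    N.IsHomogeneousSub (a • ⊤ : Submodule R N) := by
  classical
  intro x hx n
  refine Submodule.smul_induction_on (p := fun x => N.proj n x ∈ (a • ⊤ : Submodule R N)) hx ?_ ?_
  · intro r hr y _
    rw [← DirectSum.sum_support_decompose 𝒜 r, Finset.sum_smul, map_sum]
    refine sum_mem fun i _ => ?_
    have h := N.proj_smul (DirectSum.decompose 𝒜 r i).2 (n - i) y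
    rw [add_sub_cancel] at h
    rw [h]
    exact Submodule.smul_mem_smul (ha i hr) trivial
  · intro x y hx hy
    rw [map_add]
    exact add_mem hx hy

theorem exists_pow_smul_eq_zero {a : Ideal R} {F : Type v} [AddCommGroup F] [Module R F]
    [Module.Finite R F] {E : Type w} [AddCommGroup E] [Module R E] (ψ : F →ₗ[R] E)
    (hψ : ∀ x, ψ x ∈ Γ a E) : ∃ k : ℕ, ∀ x, ∀ r ∈ a ^ k, r • ψ x = 0 := by
  obtain ⟨s, hs⟩ := Module.Finite.fg_top (R := R) (M := F)
  choose k hk using hψ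
  refine ⟨s.sup k, fun x r hr => ?_⟩
  have hx : x ∈ Submodule.span R (s : Set F) := hs ▸ trivial
  refine Submodule.span_induction (p := fun x _ => r • ψ x = 0) ?_ (by simp) ?_ ?_ hx
  · intro t ht
    exact hk t r (Ideal.pow_le_pow_right (Finset.le_sup ht) hr)
  · intro x y _ _ hx hy
    rw [map_add, smul_add, hx, hy, add_zero]
  · intro c x _ hx
    rw [map_smul, smul_comm, hx, smul_zero]

/-- The graded module `Γ_𝔞(E)`. -/
def torsion (a : HomogeneousIdeal 𝒜) (E : GrMod.{u, v} 𝒜) : GrMod.{u, v} 𝒜 :=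
  E.sub (Γ a.toIdeal E) (Γ_homogeneous a E)

/-- The image of a finitely generated module in Γ_𝔞(E) is killed by a single power 𝔞ᵏ. Artin–Rees
allows replacing the target of `π` by its quotient modulo a high power of 𝔞, and every map out of
that quotient lands in the torsion. -/
theorem Extends.torsion [IsNoetherianRing R] {E : GrMod.{u, v} 𝒜} (hE : E.Extends)
    (a : HomogeneousIdeal 𝒜) : (E.torsion a).Extends := by
  intro F N _ _ π hπ n ψ hψ hker
  let ι : E.torsion a →ₗ[R] E := (Γ a.toIdeal E).subtype
  have hι : IsGradedHom ι := fun _ _ hx => hx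
  obtain ⟨k, hk⟩ := exists_pow_smul_eq_zero (a := a.toIdeal) (ι ∘ₗ ψ) fun x => (ψ x).2
  obtain ⟨m, hm⟩ := Ideal.exists_pow_inf_eq_pow_smul a.toIdeal (LinearMap.range π)
  have hhom := isHomogeneousSub_smul_top (pow_homogeneous a (m + k)) N
  let q : N →ₗ[R] N.quot _ hhom := (a.toIdeal ^ (m + k) • ⊤ : Submodule R N).mkQ
  have hq : IsGradedHom q := fun _ x hx => ⟨x, hx, rfl⟩
  have : Module.Finite R (N.quot _ hhom) := Module.Finite.of_surjective q
    (Submodule.mkQ_surjective _)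
  -- If π x lies in 𝔞^(m+k) N, Artin–Rees puts it in 𝔞ᵏ π(F), so x differs from an element of 𝔞ᵏ F
  -- by an element of ker π; `ψ` kills both.
  obtain ⟨χ, hχ, hχq⟩ := hE F (N.quot _ hhom) (q ∘ₗ π) (fun _ _ hx => hq _ _ (hπ _ _ hx)) n
    (ι ∘ₗ ψ) (hι.comp_isDegHom hψ) (by
      intro x hx
      have h1 : π x ∈ (a.toIdeal ^ (m + k) • ⊤ : Submodule R N) ⊓ LinearMap.range π :=
        ⟨(Submodule.Quotient.mk_eq_zero _).mp hx, x, rfl⟩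
      rw [hm (m + k) (Nat.le_add_right m k), Nat.add_sub_cancel_left] at h1
      have h2 : π x ∈ (a.toIdeal ^ k • ⊤ : Submodule R F).map π := by
        rw [Submodule.map_smul'', Submodule.map_top]
        exact Submodule.smul_mono le_rfl inf_le_right h1
      obtain ⟨y, hy, hyx⟩ := h2
      have h3 : ψ (x - y) = 0 := hker (by rw [LinearMap.mem_ker, map_sub, hyx, sub_self])
      have h4 : ι (ψ y) = 0 := by
        refine Submodule.smul_induction_on (p := fun y => ι (ψ y) = 0) hy ?_ ?_
        · intro r hr z _
          rw [map_smul, map_smul]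
          exact hk z r hr
        · intro y z hy hz
          rw [map_add, map_add, hy, hz, add_zero]
      rw [map_sub, sub_eq_zero] at h3
      rw [LinearMap.mem_ker, LinearMap.comp_apply, h3, h4])
  refine ⟨LinearMap.codRestrict (Γ a.toIdeal E) (χ ∘ₗ q) fun x => ⟨m + k, fun r hr => ?_⟩,
    fun d x hx => hχ d (q x) (hq d x hx), ?_⟩
  · rw [LinearMap.comp_apply, ← map_smul, ← map_smul]
    have : q (r • x) = 0 := (Submodule.Quotient.mk_eq_zero _).mpr
      (Submodule.smul_mem_smul hr trivial)
    rw [this, map_zero]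
  · ext x
    exact Subtype.ext (DFunLike.congr_fun hχq x)

end graded

/-! ### Graded free modules of finite rank -/

section free

variable {R : Type u} [CommRing R] (𝒜 : ℕ → AddSubgroup R)

/-- The component of degree `z` of `R`, which is `0` for `z < 0`. -/
def ringDeg (z : ℤ) : AddSubgroup R := if 0 ≤ z then 𝒜 z.toNat else ⊥

variable {𝒜}

theorem mem_ringDeg_of_mem {z : ℤ} {j : ℕ} (h : z = j) {r : R} (hr : r ∈ 𝒜 j) :
    r ∈ ringDeg 𝒜 z := by
  subst h
  simpa [ringDeg] using hr

theorem eq_zero_or_of_mem_ringDeg {z : ℤ} {r : R} (hr : r ∈ ringDeg 𝒜 z) :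
    r = 0 ∨ ∃ j : ℕ, z = j ∧ r ∈ 𝒜 j := by
  unfold ringDeg at hr
  split_ifs at hr with h
  · exact Or.inr ⟨z.toNat, by omega, hr⟩
  · exact Or.inl hr

theorem smul_mem_of_mem_ringDeg (N : GrMod.{u, v} 𝒜) {z m : ℤ} {r : R} {x : N}
    (hr : r ∈ ringDeg 𝒜 z) (hx : x ∈ N.deg m) : r • x ∈ N.deg (z + m) := by
  obtain rfl | ⟨j, rfl, hj⟩ := eq_zero_or_of_mem_ringDeg hr
  · rw [zero_smul]
    exact zero_mem _
  · exact N.smul_mem j m r x hj hx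

variable [GradedRing 𝒜]

variable (𝒜)

/-- The graded free module `⨁ R(-dₖ)`. -/
def free (ι : Type v) [Finite ι] (d : ι → ℤ) : GrMod.{u, max u v} 𝒜 where
  carrier := ι → R
  deg m := AddSubgroup.pi Set.univ fun k => ringDeg 𝒜 (m - d k)
  decomposition := decompositionOfProj _
    (fun m => AddMonoidHom.pi fun k => (ringProj 𝒜 (m - d k)).comp (Pi.evalAddMonoidHom _ k))
    (fun m x hx => by
      funext k
      change ringProj 𝒜 (m - d k) (x k) = x k
      obtain h | ⟨j, hj, h⟩ := eq_zero_or_of_mem_ringDeg (hx k trivial)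
      · rw [h, map_zero]
      · exact ringProj_same 𝒜 hj h)
    (fun m n hmn x hx => by
      funext k
      change ringProj 𝒜 (n - d k) (x k) = 0
      obtain h | ⟨j, hj, h⟩ := eq_zero_or_of_mem_ringDeg (hx k trivial)
      · rw [h, map_zero]
      · exact ringProj_ne 𝒜 (by omega) h)
    (fun x => by
      classical
      cases nonempty_fintype ι
      rw [← Finset.univ_sum_single x]
      refine sum_mem fun k _ => ?_
      refine ring_induction 𝒜 (p := fun r => (Pi.single k r : ι → R) ∈ _) (x k) ?_ ?_ ?_
      · rw [Pi.single_zero]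
        exact zero_mem _
      · intro a b ha hb
        rw [Pi.single_add]
        exact add_mem ha hb
      · intro i r hr
        refine AddSubgroup.mem_iSup_of_mem (i + d k) fun l _ => ?_
        by_cases h : l = k
        · subst h
          rw [Pi.single_eq_same]
          exact mem_ringDeg_of_mem (by omega) hr
        · rw [Pi.single_eq_of_ne h]
          exact zero_mem (ringDeg 𝒜 _))
  smul_mem i m r x hr hx := by
    intro k _
    obtain h | ⟨j, hj, h⟩ := eq_zero_or_of_mem_ringDeg (hx k trivial)
    · change r * x k ∈ ringDeg 𝒜 (i + m - d k)
      rw [h, mul_zero]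
      exact zero_mem _
    · exact mem_ringDeg_of_mem (j := i + j) (by push_cast; omega)
        (SetLike.GradedMul.mul_mem hr h)

variable {𝒜}

instance (ι : Type v) [Finite ι] (d : ι → ℤ) : Module.Finite R (free 𝒜 ι d) :=
  inferInstanceAs (Module.Finite R (ι → R))

/-- The basis elements of the graded free module. -/
def free.gen (ι : Type v) [Finite ι] (d : ι → ℤ) (k : ι) : free 𝒜 ι d :=
  (Pi.basisFun R ι k : ι → R)

theorem free.gen_mem (ι : Type v) [Finite ι] (d : ι → ℤ) (k : ι) :
    free.gen ι d k ∈ (free 𝒜 ι d).deg (d k) := by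
  classical
  intro l _
  change Pi.basisFun R ι k l ∈ ringDeg 𝒜 (d k - d l)
  rw [Pi.basisFun_apply]
  by_cases h : l = k
  · subst h
    rw [Pi.single_eq_same]
    exact mem_ringDeg_of_mem (j := 0) (by simp) SetLike.GradedOne.one_mem
  · rw [Pi.single_eq_of_ne h]
    exact zero_mem _

/-- The homomorphism from a graded free module with prescribed values on the basis. -/
def free.lift {ι : Type v} [Finite ι] (d : ι → ℤ) {N : Type w} [AddCommGroup N] [Module R N]
    (y : ι → N) : free 𝒜 ι d →ₗ[R] N :=
  (Pi.basisFun R ι).constr R y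

theorem free.lift_gen {ι : Type v} [Finite ι] (d : ι → ℤ) {N : Type w} [AddCommGroup N]
    [Module R N] (y : ι → N) (k : ι) : free.lift (𝒜 := 𝒜) d y (free.gen ι d k) = y k :=
  Module.Basis.constr_basis (M := ι → R) (Pi.basisFun R ι) R y k

theorem free.hom_ext {ι : Type v} [Finite ι] {d : ι → ℤ} {N : Type w} [AddCommGroup N]
    [Module R N] {f g : free 𝒜 ι d →ₗ[R] N} (h : ∀ k, f (free.gen ι d k) = g (free.gen ι d k)) :
    f = g :=
  Module.Basis.ext (M := ι → R) (Pi.basisFun R ι) h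

theorem free.lift_isDegHom {ι : Type v} [Finite ι] {d : ι → ℤ} {N : GrMod.{u, w} 𝒜} {n : ℤ}
    {y : ι → N} (hy : ∀ k, y k ∈ N.deg (d k + n)) :
    IsDegHom n (free.lift (𝒜 := 𝒜) d y) := by
  intro m x hx
  cases nonempty_fintype ι
  have : free.lift (𝒜 := 𝒜) d y x = ∑ k, x k • y k := by
    refine ((Pi.basisFun R ι).constr_apply_fintype R y x).trans ?_
    exact Finset.sum_congr rfl fun k _ => by rw [Pi.basisFun_equivFun]; rfl
  rw [this]
  refine sum_mem fun k _ => ?_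
  have := N.smul_mem_of_mem_ringDeg (hx k trivial) (hy k)
  rwa [← add_assoc, sub_add_cancel] at this

theorem free.lift_isGradedHom {ι : Type v} [Finite ι] {d : ι → ℤ} {N : GrMod.{u, w} 𝒜}
    {y : ι → N} (hy : ∀ k, y k ∈ N.deg (d k)) :
    IsGradedHom (free.lift (𝒜 := 𝒜) d y) := by
  intro m x hx
  have := free.lift_isDegHom (n := 0) (fun k => by rw [add_zero]; exact hy k) m x hx
  rwa [add_zero] at this

/-- Finitely generated graded modules are quotients of graded free modules. -/
theorem exists_free_cover (T : GrMod.{u, max u v} 𝒜) [Module.Finite R T] :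
    ∃ (ι : Type (max u v)) (_ : Finite ι) (d : ι → ℤ)
      (π : (free 𝒜 ι d : GrMod.{u, max u v} 𝒜) →ₗ[R] T),
      IsGradedHom π ∧ Function.Surjective π := by
  obtain ⟨s, hs, hst⟩ := T.exists_homogeneous_generators
  choose! d hd using hs
  refine ⟨s, inferInstance, fun t => d t, free.lift _ fun t => t.1,
    free.lift_isGradedHom fun k => hd k k.2, ?_⟩
  rw [← LinearMap.range_eq_top, eq_top_iff, ← hst, Submodule.span_le]
  intro t ht
  exact ⟨free.gen _ _ ⟨t, ht⟩, free.lift_gen _ _ _⟩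

end free

/-! ### Diagram chases in complexes that are exact in almost all degrees -/

section complex

variable {R : Type u} [CommRing R] {𝒜 : ℕ → AddSubgroup R} [GradedRing 𝒜]
  {G : ℕ → GrMod.{u, max u v} 𝒜} {d : ∀ i, G i →ₗ[R] G (i + 1)}

/-- Elementwise exactness of `G` in almost all degrees below position `f` passes to the complexes
of homogeneous homomorphisms from a finitely generated graded module `T`. -/
theorem eventually_hom_exact [IsNoetherianRing R] (hG : ∀ i, (G i).Extends)
    (hd : ∀ i, IsGradedHom (d i)) (hdd : ∀ i x, d (i + 1) (d i x) = 0) [Subsingleton (G 0)] {f : ℕ}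
    (hex : ∀ i < f, ∀ᶠ n in cofinite, ∀ z ∈ (G (i + 1)).deg n, d (i + 1) z = 0 →
      ∃ y ∈ (G i).deg n, d i y = z) :
    ∀ i < f, ∀ (T : GrMod.{u, max u v} 𝒜) [Module.Finite R T], ∀ᶠ n in cofinite,
      ∀ φ : T →ₗ[R] G (i + 1), IsDegHom n φ → d (i + 1) ∘ₗ φ = 0 →
        ∃ ψ : T →ₗ[R] G i, IsDegHom n ψ ∧ d i ∘ₗ ψ = φ := by
  intro i
  induction i with
  | zero =>
    intro hi T _
    obtain ⟨ι, _, e, π, hπ, hπs⟩ := exists_free_cover.{u, v} T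
    have h1 : ∀ᶠ n in cofinite, ∀ k : ι, ∀ z ∈ (G 1).deg (e k + n), d 1 z = 0 →
        ∃ y ∈ (G 0).deg (e k + n), d 0 y = z := by
      rw [eventually_all]
      exact fun k => (add_right_injective (e k)).tendsto_cofinite.eventually (hex 0 hi)
    filter_upwards [h1] with n hn φ hφ hdφ
    refine ⟨0, fun _ _ _ => zero_mem _, ?_⟩
    rw [LinearMap.comp_zero, ← LinearMap.cancel_right hπs]
    refine free.hom_ext fun k => ?_
    obtain ⟨y, -, hy⟩ := hn k (φ (π (free.gen ι e k))) (hφ _ _ (hπ _ _ (free.gen_mem ι e k)))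
      (DFunLike.congr_fun hdφ _)
    rw [Subsingleton.elim y 0, map_zero] at hy
    exact hy
  | succ i ih =>
    intro hi T _
    obtain ⟨ι, _, e, π, hπ, hπs⟩ := exists_free_cover.{u, v} T
    -- A map of degree n sends the k-th basis element to degree `e k + n`; finitely many translates
    -- of a cofinite condition still hold cofinitely.
    have h1 : ∀ᶠ n in cofinite, ∀ k : ι, ∀ z ∈ (G (i + 2)).deg (e k + n), d (i + 2) z = 0 →
        ∃ y ∈ (G (i + 1)).deg (e k + n), d (i + 1) y = z := by
      rw [eventually_all]
      exact fun k => (add_right_injective (e k)).tendsto_cofinite.eventually (hex (i + 1) hi)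
    let K : GrMod.{u, max u v} 𝒜 := (free 𝒜 ι e).sub (LinearMap.ker π) hπ.ker
    let j : K →ₗ[R] free 𝒜 ι e := (LinearMap.ker π).subtype
    have hj : IsGradedHom j := fun _ _ hx => hx
    have : Module.Finite R K := inferInstanceAs (Module.Finite R (LinearMap.ker π))
    filter_upwards [h1, ih (by omega) K] with n hn hK φ hφ hdφ
    choose y hy hyφ using fun k => hn k (φ (π (free.gen ι e k)))
      (hφ _ _ (hπ _ _ (free.gen_mem ι e k))) (DFunLike.congr_fun hdφ _)
    let ψ : free 𝒜 ι e →ₗ[R] G (i + 1) := free.lift e y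
    have hψ : IsDegHom n ψ := free.lift_isDegHom hy
    have hψφ : d (i + 1) ∘ₗ ψ = φ ∘ₗ π := free.hom_ext fun k => by
      rw [LinearMap.comp_apply, free.lift_gen, hyφ]
      rfl
    -- The lift `ψ` on the free cover need not descend to `T`, but on the syzygy module it is a
    -- cocycle one position lower, hence a coboundary. Subtracting the boundary of an extension of
    -- `θ` makes it descend.
    obtain ⟨θ, hθ, hdθ⟩ := hK (ψ ∘ₗ j) (hψ.comp hj) (by
      rw [← LinearMap.comp_assoc, hψφ]
      ext x
      change φ (π x.1) = 0
      rw [LinearMap.mem_ker.mp x.2, map_zero])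
    obtain ⟨θ', hθ', hθj⟩ := hG i K (free 𝒜 ι e) j hj n θ hθ (by
      intro x hx
      rw [Subtype.ext (LinearMap.mem_ker.mp hx) (a2 := (0 : LinearMap.ker π))]
      exact map_zero θ)
    obtain ⟨χ, hχ, hχπ⟩ := hG (i + 1) (free 𝒜 ι e) T π hπ n (ψ - d i ∘ₗ θ')
      (hψ.sub ((hd i).comp_isDegHom hθ')) (by
        intro x hx
        have h2 : θ' x = θ ⟨x, hx⟩ := DFunLike.congr_fun hθj (⟨x, hx⟩ : LinearMap.ker π)
        have h3 : d i (θ ⟨x, hx⟩) = ψ x := DFunLike.congr_fun hdθ (⟨x, hx⟩ : LinearMap.ker π)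
        rw [LinearMap.mem_ker, LinearMap.sub_apply, LinearMap.comp_apply, h2, h3, sub_self])
    refine ⟨χ, hχ, ?_⟩
    rw [← LinearMap.cancel_right hπs, LinearMap.comp_assoc, hχπ, LinearMap.comp_sub, hψφ]
    ext x
    simp [hdd]

/-- If `G` is exact in almost all degrees below position `f`, and so is the complex of elements
killed by `s` at position `f`, then the cohomology of `G` at position `f` has no elements killed
by `s` in almost all degrees. -/
theorem eventually_no_socle [IsNoetherianRing R] (hG : ∀ i, (G i).Extends)
    (hd : ∀ i, IsGradedHom (d i)) (hdd : ∀ i x, d (i + 1) (d i x) = 0) [Subsingleton (G 0)] {f : ℕ}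
    (hex : ∀ i < f, ∀ᶠ n in cofinite, ∀ z ∈ (G (i + 1)).deg n, d (i + 1) z = 0 →
      ∃ y ∈ (G i).deg n, d i y = z)
    {s : Finset R} (hs : (s : Set R) ⊆ 𝒜 1)
    (hsoc : ∀ᶠ n in cofinite, ∀ z ∈ (G (f + 1)).deg n, (∀ x ∈ s, x • z = 0) → d (f + 1) z = 0 →
      ∃ y ∈ (G f).deg n, d f y = z) :
    ∀ᶠ n in cofinite, ∀ z ∈ (G (f + 1)).deg n, d (f + 1) z = 0 →
      (∀ x ∈ s, ∃ y, d f y = x • z) → ∃ y ∈ (G f).deg n, d f y = z := by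
  cases f with
  | zero =>
    filter_upwards [hsoc] with n hn z hz hdz hx
    refine hn z hz (fun x hxs => ?_) hdz
    obtain ⟨y, hy⟩ := hx x hxs
    rw [← hy, Subsingleton.elim y 0, map_zero]
  | succ f =>
    let ι := ULift.{max u v} s
    -- Start of a free presentation of R/(s): one generator of degree 1 for each element of `s`,
    -- mapped to that element.
    let F : GrMod.{u, max u v} 𝒜 := free 𝒜 ι fun _ => 1
    let A : GrMod.{u, max u v} 𝒜 := free 𝒜 PUnit.{max u v + 1} fun _ => 0
    let one : A := free.gen PUnit (fun _ => 0) PUnit.unit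
    have hone : one ∈ A.deg 0 := free.gen_mem PUnit (fun _ => 0) PUnit.unit
    let π : F →ₗ[R] A := free.lift _ fun k => k.down.1 • one
    have hπ : IsGradedHom π := free.lift_isGradedHom fun k =>
      A.smul_mem 1 0 _ _ (hs k.down.2) hone
    have hπg : ∀ k, π (free.gen ι _ k) = k.down.1 • one := fun k => free.lift_gen _ _ k
    let K : GrMod.{u, max u v} 𝒜 := F.sub (LinearMap.ker π) hπ.ker
    let j : K →ₗ[R] F := (LinearMap.ker π).subtype
    have hj : IsGradedHom j := fun _ _ hx => hx
    have : Module.Finite R F := inferInstanceAs (Module.Finite R (ι → R))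
    have : Module.Finite R K := inferInstanceAs (Module.Finite R (LinearMap.ker π))
    filter_upwards [hsoc, eventually_hom_exact hG hd hdd hex f (by omega) K] with n hn hK z hz hdz hx
    have hy : ∀ k : ι, ∃ y ∈ (G (f + 1)).deg (1 + n), d (f + 1) y = k.down.1 • z := by
      intro k
      obtain ⟨y, hy⟩ := hx k.down.1 k.down.2
      refine ⟨(G (f + 1)).proj (1 + n) y, GrMod.proj_mem _ _ _, ?_⟩
      rw [← (hd _).proj, hy]
      exact GrMod.proj_same _ (GrMod.smul_mem _ 1 n _ z (hs k.down.2) hz)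
    choose y hy hyz using hy
    let ψ : F →ₗ[R] G (f + 1) := free.lift _ y
    have hψ : IsDegHom n ψ := free.lift_isDegHom hy
    have hψg : ∀ k, ψ (free.gen ι _ k) = y k := fun k => free.lift_gen _ _ k
    let ζ : A →ₗ[R] G (f + 2) := free.lift _ fun _ => z
    have hζ : ζ one = z := free.lift_gen _ _ _
    have hψζ : d (f + 1) ∘ₗ ψ = ζ ∘ₗ π := free.hom_ext fun k => by
      rw [LinearMap.comp_apply, LinearMap.comp_apply, hψg, hyz, hπg, map_smul, hζ]
    obtain ⟨θ, hθ, hdθ⟩ := hK (ψ ∘ₗ j) (hψ.comp hj) (by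
      rw [← LinearMap.comp_assoc, hψζ]
      ext x
      change ζ (π x.1) = 0
      rw [LinearMap.mem_ker.mp x.2, map_zero])
    obtain ⟨θ', hθ', hθj⟩ := hG f K F j hj n θ hθ (by
      intro x hx
      rw [Subtype.ext (LinearMap.mem_ker.mp hx) (a2 := (0 : LinearMap.ker π))]
      exact map_zero θ)
    obtain ⟨χ, hχ, hχπ⟩ := hG (f + 1) F A π hπ n (ψ - d f ∘ₗ θ')
      (hψ.sub ((hd f).comp_isDegHom hθ')) (by
        intro x hx
        have h2 : θ' x = θ ⟨x, hx⟩ := DFunLike.congr_fun hθj (⟨x, hx⟩ : LinearMap.ker π)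
        have h3 : d f (θ ⟨x, hx⟩) = ψ x := DFunLike.congr_fun hdθ (⟨x, hx⟩ : LinearMap.ker π)
        rw [LinearMap.mem_ker, LinearMap.sub_apply, LinearMap.comp_apply, h2, h3, sub_self])
    have hw : χ one ∈ (G (f + 1)).deg n := by
      have := hχ 0 one hone
      rwa [zero_add] at this
    -- From χ ∘ π = ψ - d θ' the element x χ(1) equals the chosen lift of x z up to a boundary. So d
    -- χ(1) and z have the same multiple by each x in `s`, and the cohomologous cocycle z - d χ(1)
    -- is killed by `s`.
    obtain ⟨y', hy', hdy'⟩ := hn (z - d (f + 1) (χ one)) (sub_mem hz (hd _ _ _ hw)) (by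
      intro x hxs
      have h1 := DFunLike.congr_fun hχπ (free.gen ι _ ⟨⟨x, hxs⟩⟩)
      rw [LinearMap.comp_apply, hπg, LinearMap.sub_apply, hψg, map_smul] at h1
      change x • χ one = _ at h1
      rw [smul_sub, ← map_smul, h1, map_sub, hyz, LinearMap.comp_apply, hdd, sub_zero, sub_self])
      (by rw [map_sub, hdz, hdd, sub_zero])
    exact ⟨y' + χ one, add_mem hy' hw, by rw [map_add, hdy', sub_add_cancel]⟩

end complex

/-! ### Resolutions with a zero in front, so that position i + 1 holds Eⁱ -/

section pad

variable {R : Type u} [CommRing R] {𝒜 : ℕ → AddSubgroup R}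

theorem finite_hom [IsNoetherianRing R] (T : GrMod.{u, max u v} 𝒜) [Module.Finite R T]
    (M : Type w) [AddCommGroup M] [Module R M] [Module.Finite R M] :
    Module.Finite R (T →ₗ[R] M) := by
  obtain ⟨n, π, hπ⟩ := Module.Finite.exists_fin' R T
  exact Module.Finite.of_injective (LinearMap.lcomp R M π) fun f g h =>
    (LinearMap.cancel_right hπ).mp h

/-- The complex `0 → E⁰ → E¹ → ⋯` with an additional zero in front. -/
def pad (E : ℕ → GrMod.{u, v} 𝒜) : ℕ → GrMod.{u, v} 𝒜
  | 0 => zeroModule 𝒜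
  | i + 1 => E i

namespace InjRes

variable {M : GrMod.{u, v} 𝒜} (I : InjRes M)

theorem d_comp_d (i : ℕ) (x : I.E i) : I.d (i + 1) (I.d i x) = 0 := by
  rw [← LinearMap.mem_ker, ← I.exact_succ]
  exact ⟨x, rfl⟩

/-- The differential of the padded complex. -/
def padD : ∀ i, pad I.E i →ₗ[R] pad I.E (i + 1)
  | 0 => 0
  | i + 1 => I.d i

theorem padD_graded : ∀ i, IsGradedHom (I.padD i)
  | 0 => fun _ _ _ => zero_mem _
  | i + 1 => I.graded_d i

theorem padD_padD : ∀ i x, I.padD (i + 1) (I.padD i x) = 0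
  | 0, _ => map_zero (I.d 0)
  | i + 1, x => I.d_comp_d i x

theorem pad_extends : ∀ i, (pad I.E i).Extends
  | 0 => fun _ _ _ _ _ _ _ ψ _ _ => ⟨0, fun _ _ _ => zero_mem _, by ext; rfl⟩
  | i + 1 => (I.injective i).extends

instance : Subsingleton (pad I.E 0) := inferInstanceAs (Subsingleton PUnit)

end InjRes

end pad

/-! ### Finite generation of Ext by dimension shifting -/

section ext

variable {R : Type u} [CommRing R] {𝒜 : ℕ → AddSubgroup R} [GradedRing 𝒜]

namespace InjRes

variable {M : GrMod.{u, v} 𝒜} (I : InjRes M)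

/-- The coboundaries of the complex of homomorphisms from `T` to an injective resolution. -/
def homCoboundaries (T : GrMod.{u, max u v} 𝒜) : ∀ i, Submodule R (T →ₗ[R] I.E i)
  | 0 => ⊥
  | i + 1 => LinearMap.range (LinearMap.compRight R (I.d i) : (T →ₗ[R] I.E i) →ₗ[R] _)

/-- Coboundaries on a homogeneous submodule extend to cocycles. -/
theorem exists_extension_homCoboundary {F N : GrMod.{u, max u v} 𝒜} [Module.Finite R F]
    [Module.Finite R N] {j : F →ₗ[R] N} (hj : IsGradedHom j) (hji : Function.Injective j) :
    ∀ (i : ℕ), ∀ β ∈ I.homCoboundaries F i,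
      ∃ β' : N →ₗ[R] I.E i, β' ∘ₗ j = β ∧ I.d i ∘ₗ β' = 0
  | 0, β, hβ => by
    rw [(Submodule.mem_bot R).mp hβ]
    exact ⟨0, LinearMap.zero_comp _, LinearMap.comp_zero _⟩
  | i + 1, _, ⟨θ, rfl⟩ => by
    obtain ⟨θ', hθ'⟩ := (I.injective i).extends.exists_comp_eq hj (ψ := θ)
      (by rw [LinearMap.ker_eq_bot.mpr hji]; exact bot_le)
    refine ⟨I.d i ∘ₗ θ', by rw [LinearMap.comp_assoc, hθ']; rfl, ?_⟩
    ext x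
    exact I.d_comp_d i _

/-- The cohomology of the complex of homomorphisms from a finitely generated graded module to an
injective resolution of a finitely generated graded module is finitely generated. -/
theorem exists_fg_cocycles [IsNoetherianRing R] [Module.Finite R M] (i : ℕ) :
    ∀ (T : GrMod.{u, max u v} 𝒜) [Module.Finite R T], ∃ K : Submodule R (T →ₗ[R] I.E i),
      K.FG ∧ ∀ φ : T →ₗ[R] I.E i, I.d i ∘ₗ φ = 0 → φ ∈ K ⊔ I.homCoboundaries T i := by
  induction i with
  | zero =>
    intro T _
    have := finite_hom.{u, v} T M
    let c : (T →ₗ[R] M) →ₗ[R] (T →ₗ[R] I.E 0) := LinearMap.compRight R I.ε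
    refine ⟨LinearMap.range c, Module.Finite.iff_fg.mp inferInstance,
      fun φ hφ => Submodule.mem_sup_left ?_⟩
    have h : ∀ x, φ x ∈ LinearMap.range I.ε := by
      intro x
      rw [I.exact_zero]
      exact DFunLike.congr_fun hφ x
    refine ⟨(LinearEquiv.ofInjective I.ε I.ε_injective).symm.toLinearMap ∘ₗ
      φ.codRestrict _ h, ?_⟩
    ext x
    exact congrArg Subtype.val
      ((LinearEquiv.ofInjective I.ε I.ε_injective).apply_symm_apply ⟨φ x, h x⟩)
  | succ i ih =>
    intro T _
    obtain ⟨ι, _, e, π, hπ, hπs⟩ := exists_free_cover.{u, v} T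
    let F : GrMod.{u, max u v} 𝒜 := free 𝒜 ι e
    let L : GrMod.{u, max u v} 𝒜 := F.sub (LinearMap.ker π) hπ.ker
    let j : L →ₗ[R] F := (LinearMap.ker π).subtype
    have hj : IsGradedHom j := fun _ _ hx => hx
    have hji : Function.Injective j := Subtype.val_injective
    have : Module.Finite R F := inferInstanceAs (Module.Finite R (ι → R))
    have : Module.Finite R L := inferInstanceAs (Module.Finite R (LinearMap.ker π))
    have descend : ∀ (k : ℕ) (ψ : F →ₗ[R] I.E k), ψ ∘ₗ j = 0 → ∃ η : T →ₗ[R] I.E k, η ∘ₗ π = ψ :=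
      fun k ψ hψ => (I.injective k).extends.exists_comp_eq hπ fun x hx =>
        DFunLike.congr_fun hψ (⟨x, hx⟩ : LinearMap.ker π)
    obtain ⟨K, hK, hKφ⟩ := ih L
    let Z : Submodule R (L →ₗ[R] I.E i) :=
      LinearMap.ker (LinearMap.compRight R (I.d i) : (L →ₗ[R] I.E i) →ₗ[R] _)
    have hKZ : (K ⊓ Z).FG := by
      have : IsNoetherian R K := isNoetherian_of_fg_of_noetherian K hK
      have : IsNoetherian R (K ⊓ Z : Submodule R _) := isNoetherian_of_le inf_le_left
      exact Module.Finite.iff_fg.mp inferInstance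
    obtain ⟨S, hS⟩ := hKZ
    have hext : ∀ g : L →ₗ[R] I.E i, ∃ g' : F →ₗ[R] I.E i, g' ∘ₗ j = g := fun g =>
      (I.injective i).extends.exists_comp_eq hj
        (by rw [LinearMap.ker_eq_bot.mpr hji]; exact bot_le)
    choose ex hex using hext
    -- The connecting map: extend a cocycle on the syzygy module to `F`, apply the differential, and
    -- descend to `T`.
    have hh : ∀ g ∈ Z, ∃ h : T →ₗ[R] I.E (i + 1), h ∘ₗ π = I.d i ∘ₗ ex g := fun g hg =>
      descend _ _ (by rw [LinearMap.comp_assoc, hex]; exact hg)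
    choose! h hh using hh
    refine ⟨Submodule.span R (h '' S), Submodule.fg_span (S.finite_toSet.image h),
      fun φ hφ => ?_⟩
    obtain ⟨ψ, hψ⟩ : ∃ ψ : F →ₗ[R] I.E i, I.d i ∘ₗ ψ = φ ∘ₗ π := by
      have h1 : ∀ k, ∃ y, I.d i y = φ (π (free.gen ι e k)) := fun k => by
        change _ ∈ LinearMap.range (I.d i)
        rw [I.exact_succ]
        exact DFunLike.congr_fun hφ _
      choose y hy using h1
      refine ⟨free.lift e y, free.hom_ext fun k => ?_⟩
      rw [LinearMap.comp_apply, free.lift_gen, hy]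
      rfl
    have hψZ : I.d i ∘ₗ (ψ ∘ₗ j) = 0 := by
      rw [← LinearMap.comp_assoc, hψ]
      ext x
      change φ (π x.1) = 0
      rw [LinearMap.mem_ker.mp x.2, map_zero]
    obtain ⟨κ, hκ, β, hβ, hκβ⟩ := Submodule.mem_sup.mp (hKφ _ hψZ)
    obtain ⟨β', hβ', hdβ'⟩ := I.exists_extension_homCoboundary hj hji i β hβ
    have hκZ : κ ∈ Submodule.span R (S : Set (L →ₗ[R] I.E i)) := by
      rw [hS]
      refine ⟨hκ, ?_⟩
      change I.d i ∘ₗ κ = 0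
      have h2 : κ = ψ ∘ₗ j - β' ∘ₗ j := by rw [← hκβ, hβ', add_sub_cancel_right]
      rw [h2, LinearMap.comp_sub, hψZ, ← LinearMap.comp_assoc, hdβ', LinearMap.zero_comp, sub_zero]
    -- The chosen `ex` and `h` need not be linear, so the extension of κ and its image are assembled
    -- from those of the generators.
    have hκ' : ∃ κ' : F →ₗ[R] I.E i, κ' ∘ₗ j = κ ∧
        ∃ g ∈ Submodule.span R (h '' S), g ∘ₗ π = I.d i ∘ₗ κ' := by
      refine Submodule.span_induction (p := fun κ _ => ∃ κ' : F →ₗ[R] I.E i, κ' ∘ₗ j = κ ∧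
        ∃ g ∈ Submodule.span R (h '' S), g ∘ₗ π = I.d i ∘ₗ κ') ?_ ?_ ?_ ?_ hκZ
      · intro g hg
        have hgZ : g ∈ Z := by
          have h3 : g ∈ K ⊓ Z := hS ▸ Submodule.subset_span hg
          exact h3.2
        exact ⟨ex g, hex g, h g, Submodule.subset_span ⟨g, hg, rfl⟩, hh g hgZ⟩
      · exact ⟨0, LinearMap.zero_comp _, 0, zero_mem _, by
          rw [LinearMap.zero_comp, LinearMap.comp_zero]⟩
      · rintro _ _ _ _ ⟨a, rfl, g, hg, hga⟩ ⟨b, rfl, g', hg', hgb⟩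
        exact ⟨a + b, LinearMap.add_comp _ _ _, g + g', add_mem hg hg', by
          rw [LinearMap.add_comp, hga, hgb, LinearMap.comp_add]⟩
      · rintro c _ _ ⟨a, rfl, g, hg, hga⟩
        exact ⟨c • a, LinearMap.smul_comp _ _ _, c • g, Submodule.smul_mem _ c hg, by
          rw [LinearMap.smul_comp, hga, LinearMap.comp_smul]⟩
    obtain ⟨κ', hκ'j, g, hg, hgπ⟩ := hκ'
    -- What remains of ψ vanishes on the syzygies; its descent η accounts for the coboundary in φ =
    -- g + d η.
    obtain ⟨η, hη⟩ := descend i (ψ - β' - κ') (by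
      rw [LinearMap.sub_comp, LinearMap.sub_comp, hβ', hκ'j, ← hκβ, add_sub_cancel_right, sub_self])
    refine Submodule.mem_sup.mpr ⟨g, hg, I.d i ∘ₗ η, ⟨η, rfl⟩, ?_⟩
    rw [← LinearMap.cancel_right hπs, LinearMap.add_comp, LinearMap.comp_assoc, hη, hgπ,
      LinearMap.comp_sub, LinearMap.comp_sub, hψ, hdβ', sub_zero, add_sub_cancel]

end InjRes

end ext

/-! ### Elements killed by R₊, as homomorphisms from R/R₊ -/

section socle

variable {R : Type u} [CommRing R] {𝒜 : ℕ → AddSubgroup R} [GradedRing 𝒜]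

theorem smul_proj_eq_zero {J : Ideal R} (hJ : J.IsHomogeneous 𝒜) {N : GrMod.{u, v} 𝒜} {x : N}
    (hx : ∀ r ∈ J, r • x = 0) (n : ℤ) : ∀ r ∈ J, r • N.proj n x = 0 := by
  classical
  intro r hr
  rw [← DirectSum.sum_support_decompose 𝒜 r, Finset.sum_smul]
  refine Finset.sum_eq_zero fun i _ => ?_
  rw [← N.proj_smul (DirectSum.decompose 𝒜 r i).2, hx _ (hJ i hr), map_zero]

/-- On elements killed by `R₊`, the ring acts through its component of degree zero. -/
theorem smul_eq_projZero_smul {N : Type v} [AddCommGroup N] [Module R N] {x : N}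
    (hx : ∀ r ∈ (HomogeneousIdeal.irrelevant 𝒜).toIdeal, r • x = 0) (r : R) :
    r • x = (GradedRing.proj 𝒜 0 r) • x := by
  rw [← sub_eq_zero, ← sub_smul]
  refine hx _ ?_
  refine (HomogeneousIdeal.mem_irrelevant_iff 𝒜 _).mpr ?_
  rw [map_sub, sub_eq_zero]
  exact (DirectSum.decompose_of_mem_same 𝒜 (DirectSum.decompose 𝒜 r 0).2).symm

/-- Only the degree-zero part of `r` acts on `x` and on its components, so no degrees are shifted.
-/
theorem proj_smul_of_irrelevant {N : GrMod.{u, v} 𝒜} {x : N}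
    (hx : ∀ r ∈ (HomogeneousIdeal.irrelevant 𝒜).toIdeal, r • x = 0) (r : R) (n : ℤ) :
    N.proj n (r • x) = r • N.proj n x := by
  rw [smul_eq_projZero_smul hx, smul_eq_projZero_smul
    (smul_proj_eq_zero (HomogeneousIdeal.irrelevant 𝒜).isHomogeneous hx n) r]
  have := N.proj_smul (i := 0) (DirectSum.decompose 𝒜 r 0).2 n x
  rwa [Nat.cast_zero, zero_add] at this

variable (𝒜) in
/-- `R / R₊` is the quotient of `R` by this homogeneous submodule. -/
theorem irrelevant_homogeneousSub :
    (free 𝒜 PUnit.{v + 1} fun _ => 0).IsHomogeneousSub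
      ((HomogeneousIdeal.irrelevant 𝒜).toIdeal • ⊤) :=
  isHomogeneousSub_smul_top (HomogeneousIdeal.irrelevant 𝒜).isHomogeneous _

namespace InjRes

variable {M : GrMod.{u, v} 𝒜} (I : InjRes M)

/-- The elements of `E^•` that are killed by `R₊` form an exact complex in almost all degrees. -/
theorem eventually_socle_exact [IsNoetherianRing R] [Module.Finite R M] (i : ℕ) :
    ∀ᶠ n in cofinite, ∀ z ∈ (pad I.E (i + 1)).deg n,
      (∀ r ∈ (HomogeneousIdeal.irrelevant 𝒜).toIdeal, r • z = 0) → I.padD (i + 1) z = 0 →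
        ∃ y ∈ (pad I.E i).deg n,
          (∀ r ∈ (HomogeneousIdeal.irrelevant 𝒜).toIdeal, r • y = 0) ∧ I.padD i y = z := by
  classical
  let J := (HomogeneousIdeal.irrelevant 𝒜).toIdeal
  let A : GrMod.{u, max u v} 𝒜 := free 𝒜 PUnit.{max u v + 1} fun _ => 0
  let one : A := free.gen PUnit (fun _ => 0) PUnit.unit
  let T : GrMod.{u, max u v} 𝒜 := A.quot (J • ⊤) (irrelevant_homogeneousSub.{u, max u v} 𝒜)
  let q : A →ₗ[R] T := (J • ⊤ : Submodule R A).mkQ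
  have : Module.Finite R T := Module.Finite.of_surjective q (Submodule.mkQ_surjective _)
  have hone : ∀ {P : Type (max u v)} [AddCommGroup P] [Module R P] (f : T →ₗ[R] P),
      ∀ r ∈ J, r • f (q one) = 0 := by
    intro P _ _ f r hr
    rw [← map_smul, ← map_smul]
    have : q (r • one) = 0 := (Submodule.Quotient.mk_eq_zero _).mpr
      (Submodule.smul_mem_smul hr trivial)
    rw [this, map_zero]
  obtain ⟨K, ⟨S, hS⟩, hK⟩ := I.exists_fg_cocycles i T
  choose e he using (I.E i).sum_proj
  -- Outside the finitely many degrees met by the generators of `K`, every κ in `K` has κ(1)ₙ = 0,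
  -- because these values are killed by R₊ and their R-multiples meet no new degrees. There only the
  -- coboundary part of the map 1 ↦ z contributes to z.
  have hfin : ∀ᶠ n in cofinite, n ∉ S.biUnion fun κ => e (κ (q one)) :=
    (Finset.finite_toSet _).compl_mem_cofinite
  filter_upwards [hfin] with n hn z hz hJz hdz
  have hproj : ∀ κ ∈ K, (I.E i).proj n (κ (q one)) = 0 := by
    intro κ hκ
    rw [← hS] at hκ
    refine Submodule.span_induction (p := fun κ _ => (I.E i).proj n (κ (q one)) = 0)
      ?_ (map_zero _) ?_ ?_ hκ
    · intro κ hκ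
      rw [← he (κ (q one)), map_sum]
      refine Finset.sum_eq_zero fun m hm => (I.E i).proj_ne ((I.E i).proj_mem m _) ?_
      rintro rfl
      exact hn (Finset.mem_biUnion.mpr ⟨κ, hκ, hm⟩)
    · intro a b _ _ ha hb
      rw [LinearMap.add_apply, map_add, ha, hb, add_zero]
    · intro c a _ ha
      rw [LinearMap.smul_apply, proj_smul_of_irrelevant (hone a), ha, smul_zero]
  let φ₀ : A →ₗ[R] I.E i := free.lift _ fun _ => z
  have hφ₀ : ∀ k, φ₀ (free.gen PUnit _ k) = z := fun k => free.lift_gen _ _ k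
  let φ : T →ₗ[R] I.E i := (J • ⊤ : Submodule R A).liftQ φ₀ (by
    refine Submodule.smul_le.mpr fun r hr x _ => ?_
    rw [LinearMap.mem_ker, map_smul]
    have : r • φ₀ = 0 := free.hom_ext fun k =>
      (congrArg (r • ·) (hφ₀ k)).trans (hJz r hr)
    exact DFunLike.congr_fun this x)
  have hφ1 : φ (q one) = z := hφ₀ _
  have hφ : I.d i ∘ₗ φ = 0 := by
    refine Submodule.linearMap_qext _ (free.hom_ext fun k => ?_)
    change I.d i (φ (q one)) = 0
    rw [hφ1]
    exact hdz
  obtain ⟨κ, hκ, β, hβ, hκβ⟩ := Submodule.mem_sup.mp (hK φ hφ)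
  have hzβ : z = (I.E i).proj n (β (q one)) := by
    have h1 : (I.E i).proj n z = (I.E i).proj n (κ (q one) + β (q one)) := by
      rw [← LinearMap.add_apply, hκβ, hφ1]
    rw [map_add, hproj κ hκ, zero_add] at h1
    rw [← h1]
    exact ((I.E i).proj_same hz).symm
  cases i with
  | zero =>
    rw [(Submodule.mem_bot R).mp hβ, LinearMap.zero_apply, map_zero] at hzβ
    exact ⟨0, zero_mem _, fun r _ => smul_zero r, (map_zero _).trans hzβ.symm⟩
  | succ i =>
    obtain ⟨η, rfl⟩ := hβ
    refine ⟨(I.E i).proj n (η (q one)), (I.E i).proj_mem _ _,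
      smul_proj_eq_zero (HomogeneousIdeal.irrelevant 𝒜).isHomogeneous (hone η) n, ?_⟩
    rw [hzβ]
    exact ((I.graded_d i).proj n _).symm

end InjRes

end socle

end

end GrMod

/-! ### Splitting exact complexes of injective modules -/

theorem Module.Baer.of_retract {A : Type u} [CommRing A] {P : Type v} {Q : Type w}
    [AddCommGroup P] [Module A P] [AddCommGroup Q] [Module A Q] (hP : Module.Baer A P)
    (s : Q →ₗ[A] P) (p : P →ₗ[A] Q) (h : ∀ z, p (s z) = z) : Module.Baer A Q := by
  intro I g
  obtain ⟨g', hg'⟩ := hP I (s ∘ₗ g)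
  refine ⟨p ∘ₗ g', fun x hx => ?_⟩
  rw [LinearMap.comp_apply, hg' x hx]
  exact h _

/-- A complex of injective modules that starts with zero splits as long as it is exact. -/
theorem Module.Baer.exists_section {A : Type u} [CommRing A] {S : ℕ → Type v}
    [∀ i, AddCommGroup (S i)] [∀ i, Module A (S i)] (hS : ∀ i, Module.Baer A (S i))
    (d : ∀ i, S i →ₗ[A] S (i + 1)) (hdd : ∀ i x, d (i + 1) (d i x) = 0) [Subsingleton (S 0)]
    {f : ℕ} (hex : ∀ i ≤ f, ∀ z, d (i + 1) z = 0 → ∃ y, d i y = z) :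
    ∀ i ≤ f, ∃ s : LinearMap.ker (d (i + 1)) →ₗ[A] S i, ∀ z, d i (s z) = z := by
  have step : ∀ i ≤ f, Module.Baer A (LinearMap.ker (d i)) →
      ∃ s : LinearMap.ker (d (i + 1)) →ₗ[A] S i, ∀ z, d i (s z) = z := by
    intro i hi hB
    obtain ⟨ρ, hρ⟩ := hB.extension_property (LinearMap.ker (d i)).subtype
      Subtype.val_injective LinearMap.id
    let p : S i →ₗ[A] LinearMap.ker (d (i + 1)) := (d i).codRestrict _ (hdd i)
    have hp : Function.Surjective p := fun z => by
      obtain ⟨y, hy⟩ := hex i hi z.1 z.2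
      exact ⟨y, Subtype.ext hy⟩
    -- The retraction ρ exists because the kernel is injective. The map y ↦ y - ρ y depends only on
    -- d y and differs from y by a cocycle, so it induces the section.
    let ψ : S i →ₗ[A] S i := LinearMap.id - (LinearMap.ker (d i)).subtype ∘ₗ ρ
    have hψ : LinearMap.ker p ≤ LinearMap.ker ψ := by
      intro x hx
      have hx' : d i x = 0 := congrArg Subtype.val (LinearMap.mem_ker.mp hx)
      have h1 : ρ x = ⟨x, hx'⟩ := DFunLike.congr_fun hρ ⟨x, hx'⟩
      change x - (ρ x).1 = 0
      rw [h1, sub_self]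
    refine ⟨(LinearMap.ker p).liftQ ψ hψ ∘ₗ
      (p.quotKerEquivOfSurjective hp).symm.toLinearMap, fun z => ?_⟩
    obtain ⟨y, rfl⟩ := hp z
    have h2 : (p.quotKerEquivOfSurjective hp).symm (p y) = Submodule.Quotient.mk y := by
      rw [LinearEquiv.symm_apply_eq]
      rfl
    rw [LinearMap.comp_apply, LinearEquiv.coe_coe, h2]
    change d i (y - (ρ y).1) = d i y
    rw [map_sub, LinearMap.mem_ker.mp (ρ y).2, sub_zero]
  have baer : ∀ i ≤ f, Module.Baer A (LinearMap.ker (d i)) := by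
    intro i
    induction i with
    | zero =>
      intro _ I g
      exact ⟨0, fun x hx => Subsingleton.elim _ _⟩
    | succ i ih =>
      intro hi
      obtain ⟨s, hs⟩ := step i (by omega) (ih (by omega))
      exact (hS i).of_retract s ((d i).codRestrict _ (hdd i)) fun z => Subtype.ext (hs z)
  exact fun i hi => step i hi (baer i hi)

namespace GrMod

open Filter

noncomputable section

/-! ### Socles in a fixed degree as injective R₀-modules -/

section gradeZero

variable {R : Type u} [CommRing R] {𝒜 : ℕ → AddSubgroup R} [GradedRing 𝒜]

/-- A graded module as a module over the component of degree zero of the ring. -/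
@[reducible] def gradeZeroModule (M : GrMod.{u, v} 𝒜) : Module (𝒜 0) M :=
  Module.compHom M (algebraMap (𝒜 0) R)

attribute [local instance] gradeZeroModule

theorem gradeZero_smul_def (M : GrMod.{u, v} 𝒜) (r : 𝒜 0) (x : M) : r • x = (r : R) • x := rfl

/-- The elements of degree `n` that are killed by `R₊`, as a module over the component of degree
zero of the ring. -/
def socle (M : GrMod.{u, v} 𝒜) (n : ℤ) : Submodule (𝒜 0) M where
  carrier := {x | x ∈ M.deg n ∧ ∀ r ∈ (HomogeneousIdeal.irrelevant 𝒜).toIdeal, r • x = 0}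
  zero_mem' := ⟨zero_mem _, fun r _ => smul_zero r⟩
  add_mem' := fun {x y} hx hy => ⟨add_mem hx.1 hy.1, fun r hr => by
    rw [smul_add, hx.2 r hr, hy.2 r hr, add_zero]⟩
  smul_mem' := fun c x hx => ⟨by
      have := M.smul_mem 0 n c x c.2 hx.1
      rwa [Nat.cast_zero, zero_add] at this,
    fun r hr => by rw [gradeZero_smul_def, smul_comm, hx.2 r hr, smul_zero]⟩

/-- The map induced on socles by a homomorphism of graded modules. -/
def socleMap {M : GrMod.{u, v} 𝒜} {N : GrMod.{u, w} 𝒜} {f : M →ₗ[R] N} (hf : IsGradedHom f)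
    (n : ℤ) : M.socle n →ₗ[𝒜 0] N.socle n where
  toFun x := ⟨f x, hf n x x.2.1, fun r hr => by rw [← map_smul, x.2.2 r hr, map_zero]⟩
  map_add' x y := Subtype.ext (map_add f x.1 y.1)
  map_smul' c x := Subtype.ext (map_smul f (c : R) x.1)

/-- In the Baer test, a map from an ideal I of R₀ becomes a degree-n map from the homogeneous ideal
I ⊕ R₊ of R that is zero on R₊. An extension to R is determined by its value at 1, which R₊ kills.
-/
theorem Extends.baer_socle [IsNoetherianRing R] {E : GrMod.{u, max u v} 𝒜} (hE : E.Extends)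
    (n : ℤ) : Module.Baer (𝒜 0) (E.socle n) := by
  intro I g
  let p := GradedRing.projZeroRingHom' 𝒜
  let A : GrMod.{u, max u v} 𝒜 := free 𝒜 PUnit.{max u v + 1} fun _ => 0
  let one : A := free.gen PUnit (fun _ => 0) PUnit.unit
  have hone : one ∈ A.deg 0 := free.gen_mem PUnit (fun _ => 0) PUnit.unit
  let ev : A →ₗ[R] R := (LinearMap.proj PUnit.unit : (PUnit.{max u v + 1} → R) →ₗ[R] R)
  have hev : ev one = 1 := by
    classical
    change Pi.basisFun R PUnit.{max u v + 1} PUnit.unit PUnit.unit = 1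
    rw [Pi.basisFun_apply, Pi.single_eq_same]
  have hevd : ∀ m, ∀ x ∈ A.deg m, m ≠ 0 → p (ev x) = 0 := by
    intro m x hx hm
    have hx' : ev x ∈ ringDeg 𝒜 (m - 0) := hx PUnit.unit trivial
    obtain h | ⟨j, hj, h⟩ := eq_zero_or_of_mem_ringDeg hx'
    · rw [h, map_zero]
    · exact Subtype.ext (DirectSum.decompose_of_mem_ne 𝒜 h (by omega))
  have hproj : ∀ x : A, p (ev (A.proj 0 x)) = p (ev x) := by
    intro x
    refine A.induction_homogeneous (p := fun x => p (ev (A.proj 0 x)) = p (ev x)) x ?_ ?_ ?_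
    · simp only [map_zero]
    · intro x y hx hy
      simp only [map_add, hx, hy]
    · intro m x hx
      by_cases hm : m = 0
      · subst hm
        rw [A.proj_same hx]
      · rw [A.proj_ne hx hm, hevd m x hx hm, map_zero, map_zero]
  -- This is I ⊕ R₊; including R₊ is what forces χ(1) into the socle.
  let L : Submodule R A := Submodule.comap ev (Ideal.comap p I)
  have hL : A.IsHomogeneousSub L := by
    intro x hx m
    change p (ev (A.proj m x)) ∈ I
    by_cases hm : m = 0
    · subst hm
      rw [hproj]
      exact hx
    · rw [hevd m _ (A.proj_mem m x) hm]
      exact zero_mem _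
  let ψ : A.sub L hL →ₗ[R] E :=
    { toFun := fun x => (g ⟨p (ev x.1), x.2⟩).1
      map_add' := fun x y => by
        rw [← Submodule.coe_add, ← map_add g]
        refine congrArg (fun t => (g t).1) (Subtype.ext ?_)
        change p (ev (x.1 + y.1)) = p (ev x.1) + p (ev y.1)
        rw [map_add, map_add]
      map_smul' := fun r x => by
        rw [RingHom.id_apply, smul_eq_projZero_smul (g ⟨p (ev x.1), x.2⟩).2.2 r]
        change _ = (p r • g ⟨p (ev x.1), x.2⟩).1
        rw [← map_smul]
        refine congrArg (fun t => (g t).1) (Subtype.ext ?_)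
        change p (ev (r • x.1)) = p r * p (ev x.1)
        rw [map_smul, smul_eq_mul, map_mul] }
  have hψ : ∀ (x : A) (hx : p (ev x) ∈ I), p (ev x) = 0 → ψ ⟨x, hx⟩ = 0 := by
    intro x hx h
    have h0 : (⟨p (ev x), hx⟩ : I) = 0 := Subtype.ext h
    change (g ⟨p (ev x), hx⟩).1 = 0
    rw [h0, map_zero]
    rfl
  have : Module.Finite R (A.sub L hL) := inferInstanceAs (Module.Finite R L)
  obtain ⟨χ, hχ, hχψ⟩ := hE (A.sub L hL) A L.subtype (fun _ _ hx => hx) n ψ (by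
    rintro m ⟨x, hxL⟩ hx
    by_cases hm : m = 0
    · subst hm
      rw [zero_add]
      exact (g _).2.1
    · rw [hψ x hxL (hevd m x hx hm)]
      exact zero_mem _) (by
    exact (Submodule.ker_subtype L).le.trans bot_le)
  have hχL : ∀ (x : A) (hx : p (ev x) ∈ I), χ x = (g ⟨p (ev x), hx⟩).1 := fun x hx =>
    DFunLike.congr_fun hχψ (⟨x, hx⟩ : L)
  have hy : χ one ∈ E.socle n := by
    refine ⟨?_, fun r hr => ?_⟩
    · have := hχ 0 one hone
      rwa [zero_add] at this
    · have h0 : p (ev (r • one)) = 0 := by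
        rw [map_smul, hev, smul_eq_mul, mul_one]
        exact Subtype.ext ((HomogeneousIdeal.mem_irrelevant_iff 𝒜 r).mp hr)
      have hI : p (ev (r • one)) ∈ I := h0 ▸ zero_mem I
      rw [← map_smul, hχL _ hI]
      exact hψ _ hI h0
  refine ⟨LinearMap.toSpanSingleton (𝒜 0) (E.socle n) ⟨χ one, hy⟩, fun x hx => Subtype.ext ?_⟩
  change (x : R) • χ one = _
  have h0 : p (ev ((x : R) • one)) = x := by
    rw [map_smul, hev, smul_eq_mul, mul_one]
    exact GradedRing.projZeroRingHom'_apply_coe 𝒜 x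
  have hI : p (ev ((x : R) • one)) ∈ I := h0.symm ▸ hx
  rw [← map_smul, hχL _ hI]
  exact congrArg (fun t => (g t).1) (Subtype.ext h0)

/-- The elements of `Γ_𝔞(E^•)` that are killed by `R₊` form an exact complex in almost all
degrees. -/
theorem InjRes.eventually_torsion_socle_exact [IsNoetherianRing R] {M : GrMod.{u, v} 𝒜}
    (I : InjRes M) [Module.Finite R M] (a : HomogeneousIdeal 𝒜) (f : ℕ) :
    ∀ᶠ n in cofinite, ∀ z ∈ (pad I.E (f + 1)).deg n, z ∈ Γ a.toIdeal (pad I.E (f + 1)) →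
      (∀ r ∈ (HomogeneousIdeal.irrelevant 𝒜).toIdeal, r • z = 0) → I.padD (f + 1) z = 0 →
        ∃ y ∈ (pad I.E f).deg n, y ∈ Γ a.toIdeal (pad I.E f) ∧ I.padD f y = z := by
  -- Splitting at position f needs exactness at all positions up to f in the same degree n; these
  -- are finitely many cofinite conditions.
  have hex : ∀ᶠ n in cofinite, ∀ i ∈ Finset.range (f + 1), ∀ z ∈ (pad I.E (i + 1)).deg n,
      (∀ r ∈ (HomogeneousIdeal.irrelevant 𝒜).toIdeal, r • z = 0) → I.padD (i + 1) z = 0 →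
        ∃ y ∈ (pad I.E i).deg n,
          (∀ r ∈ (HomogeneousIdeal.irrelevant 𝒜).toIdeal, r • y = 0) ∧ I.padD i y = z := by
    rw [eventually_all_finset]
    exact fun i _ => I.eventually_socle_exact i
  filter_upwards [hex] with n hn z hz hzΓ hJz hdz
  have : Subsingleton ((pad I.E 0).socle n) :=
    ⟨fun x y => Subtype.ext (Subsingleton.elim (α := pad I.E 0) _ _)⟩
  obtain ⟨s, hs⟩ := Module.Baer.exists_section (A := 𝒜 0) (S := fun i => (pad I.E i).socle n)
    (fun i => (I.pad_extends i).baer_socle n) (fun i => socleMap (I.padD_graded i) n)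
    (fun i x => Subtype.ext (I.padD_padD i x.1)) (f := f)
    (fun i hi z hz => by
      obtain ⟨y, hy, hJy, hyz⟩ := hn i (Finset.mem_range.mpr (by omega)) z.1 z.2.1 z.2.2
        (congrArg Subtype.val hz)
      exact ⟨⟨y, hy, hJy⟩, Subtype.ext hyz⟩) f le_rfl
  let z' : LinearMap.ker (socleMap (I.padD_graded (f + 1)) n) :=
    ⟨⟨z, hz, hJz⟩, Subtype.ext hdz⟩
  refine ⟨(s z').1, (s z').2.1, ?_, congrArg Subtype.val (hs z')⟩
  obtain ⟨k, hk⟩ := hzΓ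
  refine ⟨k, fun r hr => ?_⟩
  -- The degree-zero part of r lies in the homogeneous ideal 𝔞ᵏ, so it kills z, and by R₀-linearity
  -- it kills the image of z under the section.
  rw [smul_eq_projZero_smul (s z').2.2 r]
  have h0 : (GradedRing.projZeroRingHom' 𝒜 r) • z' = 0 :=
    Subtype.ext (Subtype.ext (hk _ (pow_homogeneous a k 0 hr)))
  have h1 := map_smul s (GradedRing.projZeroRingHom' 𝒜 r) z'
  rw [h0, map_zero] at h1
  exact (congrArg Subtype.val h1).symm

end gradeZero

end

end GrMod

/-! ### Jumps of a predicate on the integers -/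

open Filter in
-- The exceptions lie in an interval [c, b]. Below c, and likewise above b, `p` persists once it
-- holds, so each side has at most one jump; the rest lie in [c, b].
theorem Int.finite_setOf_not_and_succ {p : ℤ → Prop} (h : ∀ᶠ n in cofinite, p n → p (n + 1)) :
    {n : ℤ | ¬ p n ∧ p (n + 1)}.Finite := by
  have hX : {n : ℤ | ¬ (p n → p (n + 1))}.Finite := h
  obtain ⟨b, hb⟩ := hX.bddAbove
  obtain ⟨c, hc⟩ := hX.bddBelow
  have key : ∀ n m : ℤ, n < m → (∀ k, n ≤ k → k ≤ m → p k → p (k + 1)) → p (n + 1) → p m := by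
    intro n m hnm hk hp
    have hind : ∀ l, n + 1 ≤ l → l ≤ m → p l := by
      intro l hl
      induction l, hl using Int.leInduction with
      | base => exact fun _ => hp
      | succ l hl ih => exact fun hlm => hk l (by omega) (by omega) (ih (by omega))
    exact hind m (by omega) le_rfl
  have hlow : ∀ k < c, p k → p (k + 1) := fun k hk => by
    by_contra hcon
    exact absurd (hc hcon) (by omega)
  have hhigh : ∀ k > b, p k → p (k + 1) := fun k hk => by
    by_contra hcon
    exact absurd (hb hcon) (by omega)
  have h1 : ({n : ℤ | ¬ p n ∧ p (n + 1)} ∩ Set.Iio c).Subsingleton := by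
    rintro n ⟨⟨hn, hn'⟩, hnc⟩ m ⟨⟨hm, hm'⟩, hmc⟩
    simp only [Set.mem_Iio] at hnc hmc
    rcases lt_trichotomy n m with h | h | h
    · exact absurd (key n m h (fun k _ _ => hlow k (by omega)) hn') hm
    · exact h
    · exact absurd (key m n h (fun k _ _ => hlow k (by omega)) hm') hn
  have h2 : ({n : ℤ | ¬ p n ∧ p (n + 1)} ∩ Set.Ioi b).Subsingleton := by
    rintro n ⟨⟨hn, hn'⟩, hnc⟩ m ⟨⟨hm, hm'⟩, hmc⟩
    simp only [Set.mem_Ioi] at hnc hmc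
    rcases lt_trichotomy n m with h | h | h
    · exact absurd (key n m h (fun k _ _ => hhigh k (by omega)) hn') hm
    · exact h
    · exact absurd (key m n h (fun k _ _ => hhigh k (by omega)) hm') hn
  refine ((h1.finite.union h2.finite).union (Set.finite_Icc c b)).subset fun n hn => ?_
  by_cases hnc : n < c
  · exact Or.inl (Or.inl ⟨hn, hnc⟩)
  · by_cases hnb : b < n
    · exact Or.inl (Or.inr ⟨hn, hnb⟩)
    · exact Or.inr ⟨by omega, by omega⟩

/-! ### Standard graded rings: Noetherianity and generators of R₊ -/

section standard

variable {R : Type u} [CommRing R] {𝒜 : ℕ → AddSubgroup R} [GradedRing 𝒜]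

theorem IsStandardGraded.isNoetherianRing (h : IsStandardGraded 𝒜) : IsNoetherianRing R := by
  obtain ⟨h0, s, -, hs⟩ := h
  have : Algebra.FiniteType (𝒜 0) R := ⟨⟨s, hs⟩⟩
  exact Algebra.FiniteType.isNoetherianRing (𝒜 0) R

/-- `R₊` is generated by the algebra generators of degree one. -/
theorem irrelevant_le_span {s : Set R} (hs : s ⊆ 𝒜 1) (h : Algebra.adjoin (𝒜 0) s = ⊤) :
    (HomogeneousIdeal.irrelevant 𝒜).toIdeal ≤ Ideal.span s := by
  have hspan : Ideal.span s ≤ (HomogeneousIdeal.irrelevant 𝒜).toIdeal :=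
    Ideal.span_le.mpr fun x hx => HomogeneousIdeal.mem_irrelevant_of_mem 𝒜 Nat.one_pos (hs hx)
  have key : ∀ r : R, ∃ c : 𝒜 0, r - c ∈ Ideal.span s := by
    intro r
    have hr : r ∈ Algebra.adjoin (𝒜 0) s := h ▸ trivial
    induction hr using Algebra.adjoin_induction with
    | mem x hx => exact ⟨0, by simpa using Ideal.subset_span hx⟩
    | algebraMap c => exact ⟨c, by
        have : algebraMap (𝒜 0) R c = c := rfl
        rw [this, sub_self]
        exact zero_mem _⟩
    | add x y _ _ hx hy =>
      obtain ⟨c, hc⟩ := hx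
      obtain ⟨e, he⟩ := hy
      refine ⟨c + e, ?_⟩
      have := add_mem hc he
      rwa [sub_add_sub_comm] at this
    | mul x y _ _ hx hy =>
      obtain ⟨c, hc⟩ := hx
      obtain ⟨e, he⟩ := hy
      refine ⟨c * e, ?_⟩
      have h1 : x * y - ((c * e : 𝒜 0) : R) = y * (x - c) + c * (y - e) := by
        rw [SetLike.GradeZero.coe_mul]
        ring
      rw [h1]
      exact add_mem (Ideal.mul_mem_left _ _ hc) (Ideal.mul_mem_left _ _ he)
  intro r hr
  obtain ⟨c, hc⟩ := key r
  have h1 : (c : R) ∈ (HomogeneousIdeal.irrelevant 𝒜).toIdeal := by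
    have := sub_mem hr (hspan hc)
    rwa [sub_sub_cancel] at this
  have h2 : (c : R) = 0 := by
    have h3 := (HomogeneousIdeal.mem_irrelevant_iff 𝒜 _).mp h1
    rw [GradedRing.proj_apply, DirectSum.decompose_of_mem_same 𝒜 c.2] at h3
    exact h3
  rwa [h2, sub_zero] at hc

end standard

/-! ### Socles of local cohomology and tameness -/

namespace GrMod

open Filter

noncomputable section

variable {R : Type u} [CommRing R] {𝒜 : ℕ → AddSubgroup R} [GradedRing 𝒜]

namespace InjRes

variable {M : GrMod.{u, v} 𝒜} (I : InjRes M) (a : HomogeneousIdeal 𝒜)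

/-- The differential of the complex `0 → Γ_𝔞(E⁰) → Γ_𝔞(E¹) → ⋯`. -/
def torsionD (i : ℕ) : (pad I.E i).torsion a →ₗ[R] (pad I.E (i + 1)).torsion a :=
  (I.padD i).restrict (p := Γ a.toIdeal (pad I.E i)) (q := Γ a.toIdeal (pad I.E (i + 1)))
    fun x ⟨k, hk⟩ => ⟨k, fun r hr => by rw [← map_smul, hk r hr, map_zero]⟩

theorem mem_coboundaries_iff : ∀ {i : ℕ} {z : I.E i}, z ∈ I.coboundaries a i ↔
    ∃ y ∈ Γ a.toIdeal (pad I.E i), I.padD i y = z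
  | 0, _ => ⟨fun h => ⟨0, zero_mem _, ((Submodule.mem_bot R).mp h).symm⟩,
      fun ⟨_, _, h⟩ => (Submodule.mem_bot R).mpr h.symm⟩
  | _ + 1, _ => Iff.rfl

theorem cohomology_deg_eq_bot_iff {i : ℕ} {n : ℤ} : (I.cohomology a i).deg n = ⊥ ↔
    ∀ z ∈ I.cocycles a i, z ∈ (I.E i).deg n → z ∈ I.coboundaries a i := by
  rw [eq_bot_iff]
  constructor
  · intro h z hz hzn
    have h1 : (Submodule.Quotient.mk ⟨z, hz⟩ : I.cocycles a i ⧸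
        (I.coboundaries a i).comap (I.cocycles a i).subtype) = 0 :=
      h ⟨⟨z, hz⟩, hzn, rfl⟩
    have h2 := (Submodule.Quotient.mk_eq_zero _).mp h1
    exact h2
  · rintro h _ ⟨z, hz, rfl⟩
    exact (Submodule.Quotient.mk_eq_zero _).mpr (h z.1 z.2 hz)

theorem smul_mem_coboundaries {i : ℕ} {r : R}
    (hr : r ∈ Module.annihilator R (I.cohomology a i)) {z : I.E i} (hz : z ∈ I.cocycles a i) :
    r • z ∈ I.coboundaries a i := by
  have h1 : (Submodule.Quotient.mk (r • ⟨z, hz⟩) : I.cocycles a i ⧸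
      (I.coboundaries a i).comap (I.cocycles a i).subtype) = 0 :=
    Module.mem_annihilator.mp hr (Submodule.Quotient.mk ⟨z, hz⟩ : I.cocycles a i ⧸
      (I.coboundaries a i).comap (I.cocycles a i).subtype)
  have h2 := (Submodule.Quotient.mk_eq_zero _).mp h1
  exact h2

/-- If `Hⁱ_𝔞(M)` vanishes in almost all degrees for `i < f`, then almost all components of
`H^f_𝔞(M)` contain no nonzero element killed by `R₊`. -/
theorem eventually_mem_coboundaries [Module.Finite R M] [IsNoetherianRing R] {s : Finset R}
    (hs : (s : Set R) ⊆ 𝒜 1)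
    (hspan : (HomogeneousIdeal.irrelevant 𝒜).toIdeal ≤ Ideal.span (s : Set R)) {f : ℕ}
    (hf : ∀ i < f, ∀ᶠ n in cofinite, (I.cohomology a i).deg n = ⊥) :
    ∀ᶠ n in cofinite, ∀ z ∈ I.cocycles a f, z ∈ (I.E f).deg n →
      (∀ x ∈ s, x • z ∈ I.coboundaries a f) → z ∈ I.coboundaries a f := by
  have : Subsingleton ((pad I.E 0).torsion a) :=
    ⟨fun x y => Subtype.ext (Subsingleton.elim (α := pad I.E 0) _ _)⟩
  have hD : ∀ i, IsGradedHom (I.torsionD a i) := fun i n x hx => I.padD_graded i n x.1 hx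
  have hlift : ∀ (i : ℕ) (n : ℤ) (z : (pad I.E (i + 1)).torsion a),
      z ∈ ((pad I.E (i + 1)).torsion a).deg n →
      (∃ y ∈ Γ a.toIdeal (pad I.E i), I.padD i y = z.1) →
        ∃ y ∈ ((pad I.E i).torsion a).deg n, I.torsionD a i y = z := by
    rintro i n z hz ⟨y, hy, hyz⟩
    let y' : (pad I.E i).torsion a := ⟨y, hy⟩
    have hy' : I.torsionD a i y' = z := Subtype.ext hyz
    refine ⟨((pad I.E i).torsion a).proj n y', GrMod.proj_mem _ _ _, ?_⟩
    rw [← (hD i).proj, hy']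
    exact GrMod.proj_same _ hz
  -- Vanishing of the lower cohomology gives exactness of the torsion complex below f, and the split
  -- socle complex gives exactness on elements killed by `s`, which generates an ideal containing
  -- R₊.
  have key := eventually_no_socle (G := fun i => (pad I.E i).torsion a) (d := I.torsionD a)
    (fun i => (I.pad_extends i).torsion a) hD
    (fun i x => Subtype.ext (I.padD_padD i x.1)) (f := f)
    (fun i hi => by
      filter_upwards [hf i hi] with n hn z hz hdz
      refine hlift i n z hz ((I.mem_coboundaries_iff a).mp ?_)
      exact (I.cohomology_deg_eq_bot_iff a).mp hn z.1 ⟨z.2, congrArg Subtype.val hdz⟩ hz)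
    hs (by
      filter_upwards [I.eventually_torsion_socle_exact a f] with n hn z hz hxz hdz
      obtain ⟨y, -, hy, hyz⟩ := hn z.1 hz z.2 (fun r hr => by
        refine Submodule.span_induction (p := fun r _ => r • z.1 = 0) ?_ (zero_smul _ _) ?_ ?_
          (hspan hr)
        · exact fun x hx => congrArg Subtype.val (hxz x hx)
        · intro x y _ _ hx hy
          rw [add_smul, hx, hy, add_zero]
        · intro c x _ hx
          rw [smul_assoc, hx, smul_zero]) (congrArg Subtype.val hdz)
      exact hlift f n z hz ⟨y, hy, hyz⟩)
  filter_upwards [key] with n hn z hz hzn hxz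
  obtain ⟨y, -, hy⟩ := hn ⟨z, hz.1⟩ hzn (Subtype.ext hz.2) (fun x hx => by
    obtain ⟨y, hy, hyz⟩ := (I.mem_coboundaries_iff a).mp (hxz x hx)
    exact ⟨⟨y, hy⟩, Subtype.ext hyz⟩)
  exact (I.mem_coboundaries_iff a).mpr ⟨y.1, y.2, congrArg Subtype.val hy⟩

/-- If R₊^(t+1) kills a class, then R₊^t kills its multiples by `s`; these vanish by induction, so
the class is socle. The multiples sit one degree higher, so the exceptional set is translated by
one. -/
theorem eventually_mem_coboundaries_of_pow {s : Finset R} (hs : (s : Set R) ⊆ 𝒜 1) {f : ℕ}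
    (h : ∀ᶠ n in cofinite, ∀ z ∈ I.cocycles a f, z ∈ (I.E f).deg n →
      (∀ x ∈ s, x • z ∈ I.coboundaries a f) → z ∈ I.coboundaries a f) (t : ℕ) :
    ∀ᶠ n in cofinite, ∀ z ∈ I.cocycles a f, z ∈ (I.E f).deg n →
      (∀ r ∈ (HomogeneousIdeal.irrelevant 𝒜).toIdeal ^ t, r • z ∈ I.coboundaries a f) →
        z ∈ I.coboundaries a f := by
  induction t with
  | zero =>
    refine Eventually.of_forall fun n z _ _ hr => ?_
    have := hr 1 (by simp)
    rwa [one_smul] at this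
  | succ t ih =>
    filter_upwards [h, (add_right_injective (1 : ℤ)).tendsto_cofinite.eventually ih]
      with n hn hn' z hz hzn hr
    refine hn z hz hzn fun x hx => ?_
    refine hn' (x • z) (Submodule.smul_mem _ x hz) ((I.E f).smul_mem 1 n x z (hs hx) hzn)
      fun r hrt => ?_
    rw [smul_smul]
    exact hr _ (by
      rw [pow_succ]
      exact Ideal.mul_mem_mul hrt
        (HomogeneousIdeal.mem_irrelevant_of_mem 𝒜 Nat.one_pos (hs hx)))

theorem isTame_cohomology [Module.Finite R M] (hR : IsStandardGraded 𝒜) {f : ℕ}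
    (hf : ∀ i < f, (HomogeneousIdeal.irrelevant 𝒜).toIdeal ≤
      (Module.annihilator R (I.cohomology a i)).radical) : (I.cohomology a f).IsTame := by
  have := hR.isNoetherianRing
  obtain ⟨s, hs, hadj⟩ := hR.2
  have hspan := irrelevant_le_span hs hadj
  -- Strong induction is needed because the absence of socle in position i presupposes vanishing in
  -- almost all degrees at all lower positions.
  have hbdd : ∀ i < f, ∀ᶠ n in cofinite, (I.cohomology a i).deg n = ⊥ := by
    intro i
    induction i using Nat.strong_induction_on with
    | _ i ih =>
      intro hi
      obtain ⟨t, ht⟩ := Ideal.exists_pow_le_of_le_radical_of_fg (hf i hi)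
        (IsNoetherian.noetherian _)
      filter_upwards [I.eventually_mem_coboundaries_of_pow a hs
        (I.eventually_mem_coboundaries a hs hspan fun j hj => ih j hj (hj.trans hi)) t] with n hn
      rw [cohomology_deg_eq_bot_iff]
      exact fun z hz hzn => hn z hz hzn fun r hr => I.smul_mem_coboundaries a (ht hr) hz
  have htame : ∀ᶠ n in cofinite, (I.cohomology a f).deg n ≠ ⊥ →
      (I.cohomology a f).deg (n + 1) ≠ ⊥ := by
    filter_upwards [I.eventually_mem_coboundaries a hs hspan hbdd] with n hn h h'
    refine h ((I.cohomology_deg_eq_bot_iff a).mpr fun z hz hzn => hn z hz hzn fun x hx => ?_)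
    -- The multiple x z has degree n + 1, where the cohomology is zero; hence z represents a socle
    -- class.
    refine (I.cohomology_deg_eq_bot_iff a).mp h' _ (Submodule.smul_mem _ x hz) ?_
    rw [add_comm]
    exact (I.E f).smul_mem 1 n x z (hs hx) hzn
  have := Int.finite_setOf_not_and_succ htame
  simpa only [IsTame, not_not, ne_eq] using this

end InjRes

theorem le_radical_of_lt_finitenessDim {a b : HomogeneousIdeal 𝒜}
    {M : GrMod.{u, v} 𝒜} {i : ℕ} (hi : (i : ℕ∞) < finitenessDim a b M) :
    b.toIdeal ≤ (Module.annihilator R (H a i M)).radical := by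
  obtain ⟨k, hk⟩ := lt_iSup_iff.mp hi
  obtain ⟨h, hik⟩ := lt_iSup_iff.mp hk
  exact h i (by exact_mod_cast hik)

end

end GrMod

theorem mainTheorem1 {R : Type u} [CommRing R] (𝒜 : ℕ → AddSubgroup R) [GradedRing 𝒜]
    (hR : IsStandardGraded 𝒜) [IsLocalRing (𝒜 0)]
    (M : GrMod.{u, v} 𝒜) [Module.Finite R M] (a : HomogeneousIdeal 𝒜)
    (f : ℕ) (hf : GrMod.finitenessDim a (HomogeneousIdeal.irrelevant 𝒜) M = f) :
    (GrMod.H a f M).IsTame := by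
  refine GrMod.InjRes.isTame_cohomology _ a hR fun i hi =>
    GrMod.le_radical_of_lt_finitenessDim (M := M) ?_
  rw [hf]
  exact_mod_cast hi
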